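/- **Theorem 1.1.** Let $\zeta_1=1$, $\zeta_2=\frac12(-1+i\sqrt3)$, $\zeta_3=\frac12(-1-i\sqrt3)$, and put $l_{\zeta_k}=\{x\zeta_k:x\ge0\}$, $L_{\zeta_k}=\{x\zeta_k:x\in\mathbb R\}$, $l=\bigcup_k l_{\zeta_k}$, $L=\bigcup_k L_{\zeta_k}$. Let $L^2(l)$ and $L^2(L)$ be the complex Hilbert spaces of (classes of) functions on $l$ and on $L$ with $$\|f\|^2_{L^2(l)}=\sum_{k=1}^3\int_0^\infty|f(x\zeta_k)|^2\,dx<\infty,\qquad \|g\|^2_{L^2(L)}=\sum_{k=1}^3\int_{\mathbb R}|g(x\zeta_k)|^2\,dx<\infty .$$ Let $\mathbb C_-(\zeta_k)=\{\zeta_k\eta:\operatorname{Im}\eta<0\}$, and let $H^2_-(\zeta_k)\subset L^2(L_{\zeta_k})$ be the Hardy space of the $L^2$-boundary values, as $a\to0^+$, of the functions $G$ that are holomorphic in $\mathbb C_-(\zeta_k)$ with $\sup_{a>0}\int_{\mathbb R}|G(\zeta_k(\eta-ia))|^2\,d\eta<\infty$. Then $H^2_-(\zeta_1)\oplus H^2_-(\zeta_2)\oplus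 H^2_-(\zeta_3)$ is the subspace of $L^2(L)$ of those $g$ with $g|_{L_{\zeta_k}}\in H^2_-(\zeta_k)$ for $k=1,2,3$. For $f\in L^2(l)$ put $$\widetilde f_k(\lambda)=(\mathcal F_{\zeta_k}f)(\lambda)=\int_0^\infty e^{-i\lambda\zeta_kx}f(x\zeta_k)\,dx,\qquad \lambda\in L_{\overline{\zeta_k}}\quad(k=1,2,3),$$ where the integral is the limit in $L^2(L_{\overline{\zeta_k}})$ of the integrals over $(0,R]$ as $R\to\infty$ (note that $\overline{\zeta_1}=\zeta_1$, $\overline{\zeta_2}=\zeta_3$, $\overline{\zeta_3}=\zeta_2$), and let $\mathcal Ff$ be the function on $L$ that equals $\widetilde f_k$ on $L_{\overline{\zeta_k}}$, $k=1,2,3$. Then $\mathcal F$ is well defined and is a linear bijection of $L^2(l)$ onto $H^2_-(\zeta_1)\oplus H^2_-(\zeta_2)\oplus H^2_-(\zeta_3)\subset L^2(L)$ with $$\langle\mathcal Ff,\mathcal Fg\rangle_{L^2(L)}=2\pi\,\langle f,g\rangle_{L^2(l)}\qquad(f,g\in L^2(l)),$$ that is, $(2\pi)^{-1/2}\mathcal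 F$ is a unitary isomorphism between these spaces. Moreover, for every $f\in L^2(l)$ and every $k$ the integral defining $\widetilde f_k(\lambda)$ converges absolutely for all $\lambda\in\mathbb C_-(\overline{\zeta_k})$, and there it is the holomorphic function of the Hardy class whose boundary value on $L_{\overline{\zeta_k}}$ is $\widetilde f_k$. -/

import Mathlib

open MeasureTheory Filter Topology
open scoped ENNReal NNReal ComplexConjugate

namespace RayFourier

noncomputable section

/-- The three cube roots of unity `1`, `(-1 + i√3)/2`, `(-1 - i√3)/2`. -/
def zeta : Fin 3 → ℂ :=
  ![1, (-1 + Complex.I * (Real.sqrt 3 : ℝ)) / 2, (-1 - Complex.I * (Real.sqrt 3 : ℝ)) / 2]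

/-- Parametrization `x ↦ x ζ` of the straight line through `0` in the direction `ζ`. -/
def onLine (ζ : ℂ) (x : ℝ) : ℂ := (x : ℂ) * ζ

/-- Length measure on the ray `{x ζ : x ≥ 0}`, as a measure on the plane. -/
def rayMeasure (ζ : ℂ) : Measure ℂ :=
  Measure.map (onLine ζ) (volume.restrict (Set.Ici (0 : ℝ)))

/-- Length measure on the line `{x ζ : x ∈ ℝ}`, as a measure on the plane. -/
def lineMeasure (ζ : ℂ) : Measure ℂ :=
  Measure.map (onLine ζ) (volume : Measure ℝ)

/-- Length measure on the bundle `l` of the three rays. -/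
def raysMeasure : Measure ℂ := ∑ k : Fin 3, rayMeasure (zeta k)

/-- Length measure on the bundle `L` of the three lines. -/
def linesMeasure : Measure ℂ := ∑ k : Fin 3, lineMeasure (zeta k)

/-- The Hilbert space `L²(l)`, with `‖f‖² = ∑ₖ ∫₀^∞ |f (x ζₖ)|² dx`. The component `fₖ` of `f`
is the restriction of `f` to the `k`-th ray (two rays meet only at the origin, a null set). -/
abbrev L2Rays : Type := Lp ℂ 2 raysMeasure

/-- The Hilbert space `L²(L)`, with `‖g‖² = ∑ₖ ∫_ℝ |g (x ζₖ)|² dx`. -/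
abbrev L2Lines : Type := Lp ℂ 2 linesMeasure

/-- The half-plane `ℂ₋(ζ) = {ζ η : Im η < 0}`, whose boundary is the line in direction `ζ`. -/
def halfPlaneMinus (ζ : ℂ) : Set ℂ := {w | ∃ η : ℂ, η.im < 0 ∧ w = ζ * η}

/-- `G` is a function of the Hardy class `H²₋` of the half-plane `ℂ₋(ζ)` (holomorphic, with
uniformly bounded `L²` norms on the lines parallel to the boundary), and the restriction of `g`
to the boundary line is its boundary value (in the sense of `L²`). -/
structure IsHardyExtension (ζ : ℂ) (G g : ℂ → ℂ) : Prop where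
  holomorphic : DifferentiableOn ℂ G (halfPlaneMinus ζ)
  bounded : ∃ C : ℝ≥0, ∀ a : ℝ, 0 < a →
    eLpNorm (fun η : ℝ => G (ζ * ((η : ℂ) - Complex.I * (a : ℂ)))) 2 volume ≤ C
  boundary : Tendsto
    (fun a : ℝ => eLpNorm
      (fun η : ℝ => G (ζ * ((η : ℂ) - Complex.I * (a : ℂ))) - g (onLine ζ η)) 2 volume)
    (𝓝[>] 0) (𝓝 0)

/-- The restriction of `g` to the line in direction `ζ` belongs to the Hardy space `H²₋(ζ)`,
regarded through boundary values as a space of functions on that line. -/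
def MemHardyMinus (ζ : ℂ) (g : ℂ → ℂ) : Prop := ∃ G : ℂ → ℂ, IsHardyExtension ζ G g

theorem measurable_onLine (ζ : ℂ) : Measurable (onLine ζ) := by
  unfold onLine; fun_prop

theorem lineMeasure_le (k : Fin 3) : lineMeasure (zeta k) ≤ linesMeasure := by
  unfold linesMeasure
  exact Finset.single_le_sum (f := fun k => lineMeasure (zeta k))
    (fun _ _ => Measure.zero_le _) (Finset.mem_univ k)

theorem ae_onLine {k : Fin 3} {p : ℂ → Prop} (h : ∀ᵐ w ∂linesMeasure, p w) :
    ∀ᵐ η : ℝ, p (onLine (zeta k) η) :=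
  ae_of_ae_map (measurable_onLine _).aemeasurable (ae_mono (lineMeasure_le k) h)

theorem aestronglyMeasurable_onLine (g : L2Lines) (k : Fin 3) :
    AEStronglyMeasurable (fun η : ℝ => g (onLine (zeta k) η)) volume :=
  ((Lp.aestronglyMeasurable g).mono_measure (lineMeasure_le k)).comp_measurable
    (measurable_onLine _)

theorem IsHardyExtension.aestronglyMeasurable {ζ : ℂ} {G g : ℂ → ℂ}
    (h : IsHardyExtension ζ G g) {a : ℝ} (ha : 0 < a) :
    AEStronglyMeasurable (fun η : ℝ => G (ζ * ((η : ℂ) - Complex.I * (a : ℂ)))) volume := by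
  refine Continuous.aestronglyMeasurable ?_
  refine h.holomorphic.continuousOn.comp_continuous (by fun_prop) fun η => ?_
  exact ⟨_, by simpa using ha, rfl⟩

theorem IsHardyExtension.congr {ζ : ℂ} {G g g' : ℂ → ℂ} (h : IsHardyExtension ζ G g)
    (hg : ∀ᵐ η : ℝ, g' (onLine ζ η) = g (onLine ζ η)) : IsHardyExtension ζ G g' := by
  refine ⟨h.holomorphic, h.bounded, h.boundary.congr fun a => eLpNorm_congr_ae ?_⟩
  filter_upwards [hg] with η hη
  rw [hη]

theorem IsHardyExtension.add {k : Fin 3} {G₁ G₂ : ℂ → ℂ} {g₁ g₂ : L2Lines}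
    (h₁ : IsHardyExtension (zeta k) G₁ g₁) (h₂ : IsHardyExtension (zeta k) G₂ g₂) :
    IsHardyExtension (zeta k) (fun w => G₁ w + G₂ w) (fun w => g₁ w + g₂ w) := by
  refine ⟨h₁.holomorphic.add h₂.holomorphic, ?_, ?_⟩
  · obtain ⟨C₁, hC₁⟩ := h₁.bounded
    obtain ⟨C₂, hC₂⟩ := h₂.bounded
    refine ⟨C₁ + C₂, fun a ha => ?_⟩
    refine (eLpNorm_add_le (h₁.aestronglyMeasurable ha) (h₂.aestronglyMeasurable ha)
      (by norm_num)).trans ?_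
    push_cast
    exact add_le_add (hC₁ a ha) (hC₂ a ha)
  · have h0 := h₁.boundary.add h₂.boundary
    rw [add_zero] at h0
    refine tendsto_of_tendsto_of_tendsto_of_le_of_le' tendsto_const_nhds h0
      (Eventually.of_forall fun _ => zero_le) ?_
    filter_upwards [self_mem_nhdsWithin] with a ha
    refine le_trans (le_of_eq ?_) (eLpNorm_add_le
      ((h₁.aestronglyMeasurable ha).sub (aestronglyMeasurable_onLine g₁ k))
      ((h₂.aestronglyMeasurable ha).sub (aestronglyMeasurable_onLine g₂ k)) (by norm_num))
    congr 1
    funext η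
    simp only [Pi.add_apply]
    ring

theorem IsHardyExtension.const_mul {ζ : ℂ} {G g : ℂ → ℂ}
    (h : IsHardyExtension ζ G g) (c : ℂ) :
    IsHardyExtension ζ (fun w => c * G w) (fun w => c * g w) := by
  refine ⟨h.holomorphic.const_mul c, ?_, ?_⟩
  · obtain ⟨C, hC⟩ := h.bounded
    refine ⟨‖c‖₊ * C, fun a ha => ?_⟩
    refine (eLpNorm_const_smul_le (c := c)
      (f := fun η : ℝ => G (ζ * ((η : ℂ) - Complex.I * (a : ℂ))))).trans ?_
    push_cast
    exact mul_le_mul_right (hC a ha) _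
  · have h0 := ENNReal.Tendsto.const_mul (a := ‖c‖ₑ) h.boundary (Or.inr (by simp))
    rw [mul_zero] at h0
    refine h0.congr fun a => ?_
    rw [← eLpNorm_const_smul]
    congr 1
    funext η
    simp only [Pi.smul_apply, smul_eq_mul]
    ring

theorem isHardyExtension_zero (ζ : ℂ) : IsHardyExtension ζ (fun _ => 0) (fun _ => 0) := by
  refine ⟨differentiableOn_const 0, ⟨0, fun a _ => ?_⟩, ?_⟩
  · simp
  · simp

/-- The subspace `H²₋(ζ₁) ⊕ H²₋(ζ₂) ⊕ H²₋(ζ₃)` of `L²(L)`: the functions whose restriction to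
each of the three lines belongs to the Hardy space of that line. -/
def hardySum : Submodule ℂ L2Lines where
  carrier := {g | ∀ k : Fin 3, MemHardyMinus (zeta k) g}
  add_mem' := by
    intro g₁ g₂ h₁ h₂ k
    obtain ⟨G₁, hG₁⟩ := h₁ k
    obtain ⟨G₂, hG₂⟩ := h₂ k
    exact ⟨_, (hG₁.add hG₂).congr (ae_onLine (Lp.coeFn_add g₁ g₂))⟩
  zero_mem' := fun k =>
    ⟨_, (isHardyExtension_zero (zeta k)).congr (ae_onLine (Lp.coeFn_zero ℂ 2 linesMeasure))⟩
  smul_mem' := by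
    intro c g h k
    obtain ⟨G, hG⟩ := h k
    exact ⟨_, (hG.const_mul c).congr (ae_onLine (Lp.coeFn_smul c g))⟩

/-- The integrand `e^{-iλζx} f(xζ)` of the Fourier transform along the ray in direction `ζ`. -/
def rayIntegrand (ζ : ℂ) (f : ℂ → ℂ) (w : ℂ) (x : ℝ) : ℂ :=
  Complex.exp (-(Complex.I * w * ζ * (x : ℂ))) * f (onLine ζ x)

/-- The ray Fourier integral `∫₀^∞ e^{-iλζx} f(xζ) dx` at a point `λ = w` where it converges
absolutely. -/
def rayFourierIntegral (ζ : ℂ) (f : ℂ → ℂ) (w : ℂ) : ℂ :=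
  ∫ x in Set.Ioi (0 : ℝ), rayIntegrand ζ f w x

/-- For `|ζ| = 1`, the ray Fourier transform `∫₀^∞ e^{-iλζx} f(xζ) dx` of a square integrable `f`
is, for `λ` on the line in direction `ζ⁻¹ = conj ζ` (where `λζ` is real), given by `g`. As for
the usual Fourier transform on `L²`, the integral is the limit in `L²` of the truncated
integrals `∫₀^R`. -/
def IsRayFourierTransform (ζ : ℂ) (f g : ℂ → ℂ) : Prop :=
  Tendsto
    (fun R : ℝ => eLpNorm
      (fun η : ℝ => (∫ x in Set.Ioc (0 : ℝ) R, rayIntegrand ζ f (onLine (conj ζ) η) x)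
        - g (onLine (conj ζ) η)) 2 volume)
    atTop (𝓝 0)

end

end RayFourier

namespace RayFourier

open FourierTransform

/-! ### The Fourier transform on `L²(ℝ)` with kernel `e^{-iηx}` -/

/-! Parametrised by `x ↦ xζ`, the three rays and the three lines decouple, since they meet only at
the null set `{0}`. For `λ = conj ζ · η` and `|ζ| = 1` the phase is `λζx = ηx`. Each component of
the transform is therefore the Fourier transform with kernel `e^{-iηx}` of a function on the
half-line extended by zero, and complex conjugation merely permutes the three lines. Plancherel with
factor `2π` (`inner_angularFourier`) gives the inner product formula and injectivity.

Forward inclusion: at depth `a` below the boundary the kernel gains the factor `e^{-ax}`, so the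
values on a parallel line are the transform of `e^{-ax} f`. Plancherel turns domination by `f` into
the Hardy bound, and `e^{-ax} f → f` in `L²` into the boundary limit
(`isHardyExtension_rayFourierIntegral`).

Surjectivity is Paley–Wiener (`angularFourier_symm_ae_eq_zero`). Let `v` be the boundary value of a
Hardy function `H` and `u` its inverse transform. For `t ≤ 0`, pair `u` with `e^{x-t} 1_{x≤t}`. By
Plancherel this becomes the integral of `v` against `e^{izt}/(1+iz)`, whose only pole, `z = i`, lies
in the upper half-plane. Shifting the line of integration to `-i∞` shows that the integral vanishes
(`integral_horizontal_eq`, `integral_paleyKernel_mul_boundary`). Hence `∫_{-∞}^t e^x u = 0` for all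
`t ≤ 0`, and `u` is zero on the negative half-line. -/

theorem memLp_comp_mul_left {f : ℝ → ℂ} (hf : MemLp f 2 volume) {c : ℝ} (hc : c ≠ 0) :
    MemLp (fun x => f (c * x)) 2 volume := by
  have h := hf.smul_measure (c := ENNReal.ofReal |c⁻¹|) ENNReal.ofReal_ne_top
  rw [← Real.map_volume_mul_left hc] at h
  exact h.comp_of_map (measurable_const_mul c).aemeasurable

theorem ae_comp_mul_left {p : ℝ → Prop} (h : ∀ᵐ x : ℝ, p x) {c : ℝ} (hc : c ≠ 0) :
    ∀ᵐ x : ℝ, p (c * x) := by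
  refine ae_of_ae_map (measurable_const_mul c).aemeasurable ?_
  rw [Real.map_volume_mul_left hc]
  exact Measure.ae_smul_measure h _

/-- Precomposition of `L²` functions with `x ↦ c x`. -/
noncomputable def dilate (c : ℝ) (hc : c ≠ 0) (u : Lp ℂ 2 (volume : Measure ℝ)) :
    Lp ℂ 2 (volume : Measure ℝ) :=
  (memLp_comp_mul_left (Lp.memLp u) hc).toLp _

theorem coeFn_dilate (c : ℝ) (hc : c ≠ 0) (u : Lp ℂ 2 (volume : Measure ℝ)) :
    dilate c hc u =ᵐ[volume] fun x => u (c * x) :=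
  MemLp.coeFn_toLp _

theorem dilate_dilate (c d : ℝ) (hc : c ≠ 0) (hd : d ≠ 0) (h : c * d = 1)
    (u : Lp ℂ 2 (volume : Measure ℝ)) : dilate c hc (dilate d hd u) = u := by
  apply Lp.ext
  filter_upwards [coeFn_dilate c hc (dilate d hd u), ae_comp_mul_left (coeFn_dilate d hd u) hc]
    with x h1 h2
  rw [h1, h2, ← mul_assoc, mul_comm d c, h, one_mul]

/-- Precomposition with `x ↦ c x` as a linear automorphism of `L²(ℝ)`. -/
noncomputable def dilation (c : ℝ) (hc : c ≠ 0) :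
    Lp ℂ 2 (volume : Measure ℝ) ≃ₗ[ℂ] Lp ℂ 2 (volume : Measure ℝ) where
  toFun := dilate c hc
  invFun := dilate c⁻¹ (inv_ne_zero hc)
  left_inv u := dilate_dilate _ _ _ _ (inv_mul_cancel₀ hc) u
  right_inv u := dilate_dilate _ _ _ _ (mul_inv_cancel₀ hc) u
  map_add' u v := by
    apply Lp.ext
    filter_upwards [coeFn_dilate c hc (u + v), coeFn_dilate c hc u, coeFn_dilate c hc v,
      Lp.coeFn_add (dilate c hc u) (dilate c hc v), ae_comp_mul_left (Lp.coeFn_add u v) hc]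
      with x h1 h2 h3 h4 h5
    rw [h1, h5, h4, Pi.add_apply, Pi.add_apply, h2, h3]
  map_smul' a u := by
    apply Lp.ext
    filter_upwards [coeFn_dilate c hc (a • u), coeFn_dilate c hc u,
      Lp.coeFn_smul a (dilate c hc u), ae_comp_mul_left (Lp.coeFn_smul a u) hc]
      with x h1 h2 h3 h4
    rw [h1, h4, RingHom.id_apply, h3, Pi.smul_apply, Pi.smul_apply, h2]

theorem coeFn_dilation (c : ℝ) (hc : c ≠ 0) (u : Lp ℂ 2 (volume : Measure ℝ)) :
    dilation c hc u =ᵐ[volume] fun x => u (c * x) :=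
  coeFn_dilate c hc u

theorem inner_dilation (c : ℝ) (hc : c ≠ 0) (u v : Lp ℂ 2 (volume : Measure ℝ)) :
    inner ℂ (dilation c hc u) (dilation c hc v) = (|c⁻¹| : ℝ) * inner ℂ u v := by
  rw [L2.inner_def, L2.inner_def]
  have : ∫ x, inner ℂ (dilation c hc u x) (dilation c hc v x)
      = ∫ x, (fun y => inner ℂ (u y) (v y)) (c * x) := by
    refine integral_congr_ae ?_
    filter_upwards [coeFn_dilation c hc u, coeFn_dilation c hc v] with x h1 h2
    rw [h1, h2]
  rw [this, Measure.integral_comp_mul_left (fun y => inner ℂ (u y) (v y)) c, Complex.real_smul]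

/-- The Fourier transform on `L²` of an integrable function is given by the Fourier integral. -/
theorem coeFn_fourier_ae_eq {u : ℝ → ℂ} (h1 : Integrable u) (h2 : MemLp u 2 volume) :
    (𝓕 (h2.toLp u) : Lp ℂ 2 (volume : Measure ℝ)) =ᵐ[volume] 𝓕 u := by
  have hc : Continuous (𝓕 u) :=
    VectorFourier.fourierIntegral_continuous Real.continuous_fourierChar
      (by exact continuous_inner) h1
  have hl : LocallyIntegrable (fun x => (𝓕 (h2.toLp u) : Lp ℂ 2 (volume : Measure ℝ)) x - 𝓕 u x)
      volume :=
    ((Lp.memLp _).locallyIntegrable (by norm_num)).sub hc.locallyIntegrable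
  -- Both sides are compared as distributions: against a test function, the transform moves onto the
  -- test function in either case.
  have key := ae_eq_zero_of_integral_contDiff_smul_eq_zero hl ?_
  · filter_upwards [key] with x hx using sub_eq_zero.mp hx
  intro g hg hgc
  have hg₁ : HasCompactSupport (Complex.ofRealCLM ∘ g) := hgc.comp_left rfl
  have hg₂ : ContDiff ℝ (⊤ : ℕ∞) (Complex.ofRealCLM ∘ g) := by fun_prop
  set φ : SchwartzMap ℝ ℂ := hg₁.toSchwartzMap hg₂ with hφ
  have hφg : ∀ x, φ x = (g x : ℂ) := fun x => rfl
  have e1 := congrArg (fun T => T φ) (Lp.fourier_toTemperedDistribution_eq (h2.toLp u))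
  simp only [TemperedDistribution.fourier_apply, Lp.toTemperedDistribution_apply] at e1
  have e2 : ∫ x, (𝓕 φ : SchwartzMap ℝ ℂ) x • h2.toLp u x = ∫ x, φ x • 𝓕 u x := by
    have : ∫ x, (𝓕 φ : SchwartzMap ℝ ℂ) x • h2.toLp u x = ∫ x, (𝓕 (φ : ℝ → ℂ)) x • u x := by
      refine integral_congr_ae ?_
      filter_upwards [h2.coeFn_toLp] with x hx
      rw [hx, SchwartzMap.fourier_coe]
    rw [this]
    have h3 := VectorFourier.integral_fourierIntegral_smul_eq_flip (μ := (volume : Measure ℝ))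
      (ν := (volume : Measure ℝ)) (L := innerₗ ℝ)
      Real.continuous_fourierChar (by exact continuous_inner) (φ.integrable (μ := volume)) h1
    rw [flip_innerₗ] at h3
    exact h3
  have i1 : Integrable (fun x => φ x • (𝓕 (h2.toLp u) : Lp ℂ 2 (volume : Measure ℝ)) x) :=
    (φ.memLp 2 volume).integrable_mul (Lp.memLp _)
  have i2 : Integrable (fun x => φ x • 𝓕 u x) := by
    refine (φ.integrable (μ := volume)).mul_bdd (c := ∫ x, ‖u x‖) hc.aestronglyMeasurable ?_
    exact Eventually.of_forall fun x => VectorFourier.norm_fourierIntegral_le_integral_norm _ _ _ _ _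
  calc ∫ x, g x • ((𝓕 (h2.toLp u) : Lp ℂ 2 (volume : Measure ℝ)) x - 𝓕 u x)
      = ∫ x, (φ x • (𝓕 (h2.toLp u) : Lp ℂ 2 (volume : Measure ℝ)) x - φ x • 𝓕 u x) := by
        refine integral_congr_ae (Eventually.of_forall fun x => ?_)
        simp only [hφg, Complex.real_smul, smul_eq_mul]
        ring
    _ = 0 := by rw [integral_sub i1 i2, ← e1, e2, sub_self]

/-- The Fourier transform `u ↦ ∫ e^{-iηx} u(x) dx` on `L²(ℝ)`. -/
noncomputable def angularFourier :
    Lp ℂ 2 (volume : Measure ℝ) ≃ₗ[ℂ] Lp ℂ 2 (volume : Measure ℝ) :=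
  (Lp.fourierTransformₗᵢ ℝ ℂ).toLinearEquiv ≪≫ₗ
    -- `𝓕` has kernel `e^{-2πiξx}`; evaluating at `ξ = η/2π` gives `e^{-iηx}`, and the dilation
    -- brings in the factor `2π` of Plancherel.
    dilation (2 * Real.pi)⁻¹ (inv_ne_zero (by positivity))

theorem inner_angularFourier (u v : Lp ℂ 2 (volume : Measure ℝ)) :
    inner ℂ (angularFourier u) (angularFourier v) = 2 * (Real.pi : ℂ) * inner ℂ u v := by
  have h : |((2 * Real.pi)⁻¹)⁻¹| = 2 * Real.pi := by
    rw [inv_inv, abs_of_pos (by positivity)]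
  have := inner_dilation (2 * Real.pi)⁻¹ (inv_ne_zero (by positivity))
    (Lp.fourierTransformₗᵢ ℝ ℂ u) (Lp.fourierTransformₗᵢ ℝ ℂ v)
  rw [h, LinearIsometryEquiv.inner_map_map] at this
  push_cast at this
  exact this

theorem norm_angularFourier (u : Lp ℂ 2 (volume : Measure ℝ)) :
    ‖angularFourier u‖ = Real.sqrt (2 * Real.pi) * ‖u‖ := by
  have h := inner_angularFourier u u
  rw [inner_self_eq_norm_sq_to_K, inner_self_eq_norm_sq_to_K] at h
  have h' : ‖angularFourier u‖ ^ 2 = 2 * Real.pi * ‖u‖ ^ 2 := by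
    apply Complex.ofReal_injective
    push_cast
    exact h
  rw [← Real.sqrt_sq (norm_nonneg (angularFourier u)), h', Real.sqrt_mul (by positivity),
    Real.sqrt_sq (norm_nonneg u)]

theorem coeFn_angularFourier_ae_eq {u : ℝ → ℂ} (h1 : Integrable u) (h2 : MemLp u 2 volume) :
    angularFourier (h2.toLp u) =ᵐ[volume]
      fun η : ℝ => ∫ x : ℝ, Complex.exp (-(Complex.I * η * x)) * u x := by
  have hc : (2 * Real.pi)⁻¹ ≠ 0 := inv_ne_zero (by positivity)
  filter_upwards [coeFn_dilation (2 * Real.pi)⁻¹ hc (𝓕 (h2.toLp u)),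
    ae_comp_mul_left (coeFn_fourier_ae_eq h1 h2) hc] with η h3 h4
  refine h3.trans (h4.trans ?_)
  rw [Real.fourier_real_eq_integral_exp_smul]
  refine integral_congr_ae (Eventually.of_forall fun x => ?_)
  simp only [smul_eq_mul]
  congr 2
  push_cast
  have : (Real.pi : ℂ) ≠ 0 := by exact_mod_cast Real.pi_ne_zero
  field_simp

/-- Plancherel's theorem for the difference of a Fourier integral and a Fourier transform. -/
theorem eLpNorm_fourierIntegral_sub {u : ℝ → ℂ} (h1 : Integrable u) (h2 : MemLp u 2 volume)
    (v : Lp ℂ 2 (volume : Measure ℝ)) :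
    eLpNorm (fun η : ℝ => (∫ x : ℝ, Complex.exp (-(Complex.I * η * x)) * u x)
      - angularFourier v η) 2 volume
      = ENNReal.ofReal (Real.sqrt (2 * Real.pi)) * eLpNorm (fun x => u x - v x) 2 volume := by
  have e1 : eLpNorm (fun η : ℝ => (∫ x : ℝ, Complex.exp (-(Complex.I * η * x)) * u x)
      - angularFourier v η) 2 volume = ‖angularFourier (h2.toLp u - v)‖ₑ := by
    rw [Lp.enorm_def, map_sub]
    refine eLpNorm_congr_ae ?_
    filter_upwards [Lp.coeFn_sub (angularFourier (h2.toLp u)) (angularFourier v),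
      coeFn_angularFourier_ae_eq h1 h2] with η h3 h4
    rw [h3, Pi.sub_apply, h4]
  have e2 : eLpNorm (fun x => u x - v x) 2 volume = ‖h2.toLp u - v‖ₑ := by
    rw [Lp.enorm_def]
    refine eLpNorm_congr_ae ?_
    filter_upwards [Lp.coeFn_sub (h2.toLp u) v, h2.coeFn_toLp] with η h3 h4
    rw [h3, Pi.sub_apply, h4]
  rw [e1, e2, ← ofReal_norm, ← ofReal_norm, norm_angularFourier,
    ENNReal.ofReal_mul (Real.sqrt_nonneg _)]

theorem eLpNorm_fourierIntegral {u : ℝ → ℂ} (h1 : Integrable u) (h2 : MemLp u 2 volume) :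
    eLpNorm (fun η : ℝ => ∫ x : ℝ, Complex.exp (-(Complex.I * η * x)) * u x) 2 volume
      = ENNReal.ofReal (Real.sqrt (2 * Real.pi)) * eLpNorm u 2 volume := by
  have h := eLpNorm_fourierIntegral_sub h1 h2 0
  rw [map_zero] at h
  have z := Lp.coeFn_zero ℂ 2 (volume : Measure ℝ)
  rw [eLpNorm_congr_ae (g := fun η : ℝ => ∫ x : ℝ, Complex.exp (-(Complex.I * η * x)) * u x),
    eLpNorm_congr_ae (f := fun x => u x - _) (g := u)] at h
  · exact h
  · filter_upwards [z] with x hx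
    simp
  · filter_upwards [z] with x hx
    simp

/-- Dominated convergence in `L²`. -/
theorem tendsto_eLpNorm_two_of_dominated {α ι : Type*} [MeasurableSpace α] {μ : Measure α}
    {l : Filter ι} [l.IsCountablyGenerated] {F : ι → α → ℂ} {b : α → ℝ}
    (hF : ∀ᶠ i in l, AEStronglyMeasurable (F i) μ) (hb : MemLp b 2 μ)
    (hle : ∀ᶠ i in l, ∀ᵐ x ∂μ, ‖F i x‖ ≤ b x)
    (hlim : ∀ᵐ x ∂μ, Tendsto (fun i => F i x) l (𝓝 0)) :
    Tendsto (fun i => eLpNorm (F i) 2 μ) l (𝓝 0) := by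
  have e : ∀ f : α → ℂ, eLpNorm f 2 μ = (∫⁻ x, ‖f x‖ₑ ^ (2 : ℝ) ∂μ) ^ (1 / 2 : ℝ) := fun f => by
    rw [eLpNorm_eq_lintegral_rpow_enorm_toReal (by norm_num) (by norm_num)]
    simp
  simp only [e]
  have h0 : Tendsto (fun i => ∫⁻ x, ‖F i x‖ₑ ^ (2 : ℝ) ∂μ) l (𝓝 (∫⁻ x, 0 ∂μ)) := by
    refine tendsto_lintegral_filter_of_dominated_convergence' (fun x => ‖b x‖ₑ ^ (2 : ℝ)) ?_ ?_ ?_ ?_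
    · filter_upwards [hF] with i hi using hi.enorm.pow_const _
    · filter_upwards [hle] with i hi
      filter_upwards [hi] with x hx
      gcongr
      exact enorm_le_iff_norm_le.mpr (hx.trans (le_abs_self _))
    · have := lintegral_rpow_enorm_lt_top_of_eLpNorm_lt_top (by norm_num) (by norm_num) hb.2
      simpa using this.ne
    · filter_upwards [hlim] with x hx
      have := (ENNReal.continuous_rpow_const (y := 2)).tendsto 0
      have h2 : Tendsto (fun i => ‖F i x‖ₑ) l (𝓝 0) := by simpa using hx.enorm
      simpa [Function.comp_def] using this.comp h2
  have := ((ENNReal.continuous_rpow_const (y := (1 / 2 : ℝ))).tendsto 0)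
  rw [lintegral_zero] at h0
  simpa [Function.comp_def] using this.comp h0

/-! ### The Fourier transform of a square integrable function on a ray -/

theorem memLp_exp_neg_mul {δ : ℝ} (hδ : 0 < δ) :
    MemLp (fun x : ℝ => Real.exp (-δ * x)) 2 (volume.restrict (Set.Ioi 0)) := by
  rw [memLp_two_iff_integrable_sq (by fun_prop)]
  refine (exp_neg_integrableOn_Ioi 0 (b := 2 * δ) (by positivity)).congr
    (Eventually.of_forall fun x => ?_)
  simp only [← Real.exp_nat_mul]
  congr 1
  push_cast
  ring

/-- From `s ≤ e^s` at `s = δx/2`, half of the decay absorbs the factor `x`. This dominates the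
`w`-derivative of the kernel. -/
theorem memLp_mul_exp_neg_mul {δ : ℝ} (hδ : 0 < δ) :
    MemLp (fun x : ℝ => x * Real.exp (-δ * x)) 2 (volume.restrict (Set.Ioi 0)) := by
  refine ((memLp_exp_neg_mul (half_pos hδ)).const_mul (2 / δ)).mono' (by fun_prop) ?_
  filter_upwards [ae_restrict_mem measurableSet_Ioi] with x hx
  have hx : 0 < x := hx
  rw [Real.norm_of_nonneg (by positivity)]
  have h1 : δ / 2 * x ≤ Real.exp (δ / 2 * x) := by linarith [Real.add_one_le_exp (δ / 2 * x)]
  have h2 : Real.exp (-δ * x) = Real.exp (-(δ / 2) * x) * (Real.exp (δ / 2 * x))⁻¹ := by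
    rw [← Real.exp_neg, ← Real.exp_add]
    congr 1
    ring
  rw [h2, ← mul_assoc, mul_comm x, mul_assoc, mul_comm (2 / δ)]
  gcongr
  rw [← div_eq_mul_inv, div_le_div_iff₀ (Real.exp_pos _) hδ]
  linarith

theorem norm_exp_rayKernel (ζ w : ℂ) (x : ℝ) :
    ‖Complex.exp (-(Complex.I * w * ζ * (x : ℂ)))‖ = Real.exp ((w * ζ).im * x) := by
  rw [Complex.norm_exp]
  congr 1
  have : -(Complex.I * w * ζ * (x : ℂ)) = -(Complex.I * (w * ζ) * x) := by ring
  rw [this]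
  simp
  ring

section Ray

variable {ζ : ℂ} {f : ℂ → ℂ}

theorem integrableOn_rayIntegrand
    (hf : MemLp (fun x : ℝ => f (onLine ζ x)) 2 (volume.restrict (Set.Ioi 0)))
    {w : ℂ} (hw : (w * ζ).im < 0) :
    IntegrableOn (rayIntegrand ζ f w) (Set.Ioi 0) := by
  have h := (memLp_exp_neg_mul (neg_pos.mpr hw)).integrable_mul hf.norm
  refine h.mono' ?_ (Eventually.of_forall fun x => ?_)
  · exact (Continuous.aestronglyMeasurable (by fun_prop)).mul hf.1
  · rw [rayIntegrand, norm_mul, norm_exp_rayKernel, neg_neg, Pi.mul_apply]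

theorem differentiableAt_rayFourierIntegral
    (hf : MemLp (fun x : ℝ => f (onLine ζ x)) 2 (volume.restrict (Set.Ioi 0)))
    {w : ℂ} (hw : (w * ζ).im < 0) :
    DifferentiableAt ℂ (rayFourierIntegral ζ f) w := by
  -- Giving up half of the decay rate at `w` leaves a rate `δ` valid on a whole neighbourhood, as
  -- differentiation under the integral requires.
  obtain ⟨δ, hδ, hδw⟩ : ∃ δ : ℝ, 0 < δ ∧ (w * ζ).im < -δ :=
    ⟨-(w * ζ).im / 2, by linarith, by linarith⟩
  have hs : {z : ℂ | (z * ζ).im < -δ} ∈ 𝓝 w :=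
    (isOpen_lt (by fun_prop) continuous_const).mem_nhds hδw
  have hm : ∀ z : ℂ, AEStronglyMeasurable (rayIntegrand ζ f z) (volume.restrict (Set.Ioi 0)) :=
    fun z => (Continuous.aestronglyMeasurable (by fun_prop)).mul hf.1
  refine (hasDerivAt_integral_of_dominated_loc_of_deriv_le
    (F := rayIntegrand ζ f)
    (F' := fun z x => -(Complex.I * ζ * x) * rayIntegrand ζ f z x)
    (bound := fun x => ‖ζ‖ * (x * Real.exp (-δ * x) * ‖f (onLine ζ x)‖))
    hs (Eventually.of_forall hm) (integrableOn_rayIntegrand hf hw) ?_ ?_ ?_ ?_).2.differentiableAt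
  · exact (Continuous.aestronglyMeasurable (by fun_prop)).mul (hm w)
  · filter_upwards [ae_restrict_mem measurableSet_Ioi] with x hx z hz
    have hx : 0 < x := hx
    have hz : (z * ζ).im < -δ := hz
    rw [rayIntegrand, norm_mul, norm_mul, norm_exp_rayKernel]
    simp only [norm_neg, norm_mul, Complex.norm_I, one_mul, Complex.norm_real,
      Real.norm_of_nonneg hx.le]
    rw [mul_assoc, mul_assoc]
    gcongr
  · exact ((memLp_mul_exp_neg_mul hδ).integrable_mul hf.norm).const_mul _
  · refine Eventually.of_forall fun x z _ => ?_
    have h1 : HasDerivAt (fun z : ℂ => -(Complex.I * z * ζ * (x : ℂ)))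
        (-(Complex.I * ζ * x)) z := by
      have := (((hasDerivAt_id z).const_mul Complex.I).mul_const (ζ * x)).neg
      refine (this.congr_deriv (by ring)).congr_of_eventuallyEq
        (Eventually.of_forall fun y => ?_)
      simp only [id, Pi.neg_apply]
      ring
    refine (h1.cexp.mul_const (f (onLine ζ x))).congr_deriv ?_
    rw [rayIntegrand]
    ring

/-- The kernel at depth `a` factors as `e^{-iηx} e^{-ax}`. Parallel lines (`a > 0`, `s = (0,∞)`) and
truncated boundary integrals (`a = 0`, `s = (0,R]`) thus both become Fourier integrals on `ℝ`. -/
theorem setIntegral_rayIntegrand_eq (hζ : ζ * conj ζ = 1) (η : ℝ) (a : ℝ) {s : Set ℝ}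
    (hs : MeasurableSet s) :
    ∫ x in s, rayIntegrand ζ f (conj ζ * ((η : ℂ) - Complex.I * a)) x
      = ∫ x : ℝ, Complex.exp (-(Complex.I * η * x)) *
          s.indicator (fun x => (Real.exp (-a * x) : ℂ) * f (onLine ζ x)) x := by
  rw [← integral_indicator hs]
  refine integral_congr_ae (Eventually.of_forall fun x => ?_)
  by_cases hx : x ∈ s
  · simp only [Set.indicator_of_mem hx, rayIntegrand]
    rw [Complex.ofReal_exp, ← mul_assoc (Complex.exp _) (Complex.exp _), ← Complex.exp_add]
    congr 2
    push_cast
    linear_combination (-(Complex.I * η * x) + Complex.I ^ 2 * a * x) * hζ + (a * x) * Complex.I_sq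
  · simp only [Set.indicator_of_notMem hx, mul_zero]

theorem memLp_indicator_exp_mul {φ : ℝ → ℂ}
    (hφ : MemLp φ 2 (volume.restrict (Set.Ioi 0))) {a : ℝ} (ha : 0 ≤ a) :
    MemLp ((Set.Ioi 0).indicator (fun x : ℝ => (Real.exp (-a * x) : ℂ) * φ x)) 2 volume := by
  rw [memLp_indicator_iff_restrict measurableSet_Ioi]
  refine hφ.of_le ((Continuous.aestronglyMeasurable (by fun_prop)).mul hφ.1) ?_
  filter_upwards [ae_restrict_mem measurableSet_Ioi] with x hx
  have hx : 0 < x := hx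
  rw [norm_mul, Complex.norm_real, Real.norm_of_nonneg (Real.exp_pos _).le]
  exact mul_le_of_le_one_left (norm_nonneg _) (Real.exp_le_one_iff.mpr (by nlinarith))

theorem integrable_indicator_exp_mul {φ : ℝ → ℂ}
    (hφ : MemLp φ 2 (volume.restrict (Set.Ioi 0))) {a : ℝ} (ha : 0 < a) :
    Integrable ((Set.Ioi 0).indicator (fun x : ℝ => (Real.exp (-a * x) : ℂ) * φ x)) := by
  rw [integrable_indicator_iff measurableSet_Ioi]
  exact MemLp.integrable_mul (p := 2) (q := 2) (memLp_exp_neg_mul ha).ofReal hφ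

theorem mul_mem_halfPlaneMinus_conj (hζ : ζ * conj ζ = 1) {w : ℂ}
    (hw : w ∈ halfPlaneMinus (conj ζ)) : (w * ζ).im < 0 := by
  obtain ⟨η, hη, rfl⟩ := hw
  rwa [mul_right_comm, mul_comm (conj ζ), hζ, one_mul]

/-- The Fourier integral of a square integrable function on a ray is a Hardy function whose
boundary value is the Fourier transform of the function. -/
theorem isHardyExtension_rayFourierIntegral (hζ : ζ * conj ζ = 1)
    (hf : MemLp (fun x : ℝ => f (onLine ζ x)) 2 (volume.restrict (Set.Ioi 0)))
    {u : Lp ℂ 2 (volume : Measure ℝ)}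
    (hu : u =ᵐ[volume] (Set.Ioi 0).indicator fun x : ℝ => f (onLine ζ x)) {g : ℂ → ℂ}
    (hg : ∀ᵐ η : ℝ, g (onLine (conj ζ) η) = angularFourier u η) :
    IsHardyExtension (conj ζ) (rayFourierIntegral ζ f) g := by
  have h0 := memLp_indicator_exp_mul hf le_rfl
  simp only [neg_zero, zero_mul, Real.exp_zero, Complex.ofReal_one, one_mul] at h0
  refine ⟨fun w hw => (differentiableAt_rayFourierIntegral hf
    (mul_mem_halfPlaneMinus_conj hζ hw)).differentiableWithinAt, ?_, ?_⟩
  · set C := ENNReal.ofReal (Real.sqrt (2 * Real.pi)) *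
      eLpNorm ((Set.Ioi 0).indicator fun x : ℝ => f (onLine ζ x)) 2 volume with hC
    refine ⟨C.toNNReal, fun a ha => ?_⟩
    rw [ENNReal.coe_toNNReal (ENNReal.mul_ne_top ENNReal.ofReal_ne_top h0.eLpNorm_ne_top)]
    simp only [rayFourierIntegral, setIntegral_rayIntegrand_eq hζ _ _ measurableSet_Ioi]
    rw [eLpNorm_fourierIntegral (integrable_indicator_exp_mul hf ha)
      (memLp_indicator_exp_mul hf ha.le)]
    refine mul_le_mul_right (eLpNorm_mono fun x => ?_) _
    by_cases hx : x ∈ Set.Ioi (0 : ℝ)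
    · rw [Set.indicator_of_mem hx, Set.indicator_of_mem hx, norm_mul, Complex.norm_real,
        Real.norm_of_nonneg (Real.exp_pos _).le]
      have hx : 0 < x := hx
      exact mul_le_of_le_one_left (norm_nonneg _) (Real.exp_le_one_iff.mpr (by nlinarith))
    · rw [Set.indicator_of_notMem hx, Set.indicator_of_notMem hx]
  -- By Plancherel the boundary limit amounts to `e^{-ax} f → f` in `L²`, which holds by domination
  -- by `2|f|`.
  · have key : Tendsto (fun a : ℝ => eLpNorm (fun x =>
        (Set.Ioi 0).indicator (fun x : ℝ => (Real.exp (-a * x) : ℂ) * f (onLine ζ x)) x - u x)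
        2 volume) (𝓝[>] 0) (𝓝 0) := by
      refine tendsto_eLpNorm_two_of_dominated
        (b := fun x => 2 * ‖(Set.Ioi 0).indicator (fun x : ℝ => f (onLine ζ x)) x‖)
        ?_ (h0.norm.const_mul 2) ?_ ?_
      · filter_upwards [self_mem_nhdsWithin] with a ha
        exact (memLp_indicator_exp_mul hf (le_of_lt ha)).1.sub (Lp.memLp u).1
      · filter_upwards [self_mem_nhdsWithin] with a ha
        have ha : 0 < a := ha
        filter_upwards [hu] with x hx
        rw [hx]
        refine (norm_sub_le _ _).trans ?_
        rw [two_mul]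
        gcongr
        by_cases hx : x ∈ Set.Ioi (0 : ℝ)
        · rw [Set.indicator_of_mem hx, Set.indicator_of_mem hx, norm_mul, Complex.norm_real,
            Real.norm_of_nonneg (Real.exp_pos _).le]
          have hx : 0 < x := hx
          exact mul_le_of_le_one_left (norm_nonneg _) (Real.exp_le_one_iff.mpr (by nlinarith))
        · rw [Set.indicator_of_notMem hx, Set.indicator_of_notMem hx]
      · filter_upwards [hu] with x hx
        rw [hx]
        by_cases hx : x ∈ Set.Ioi (0 : ℝ)
        · simp only [Set.indicator_of_mem hx]
          have : Continuous fun a : ℝ =>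
              (Real.exp (-a * x) : ℂ) * f (onLine ζ x) - f (onLine ζ x) := by fun_prop
          refine Tendsto.mono_left ?_ nhdsWithin_le_nhds
          simpa using this.tendsto 0
        · simp only [Set.indicator_of_notMem hx, sub_self]
          exact tendsto_const_nhds
    have key2 := ENNReal.Tendsto.const_mul (a := ENNReal.ofReal (Real.sqrt (2 * Real.pi))) key
      (Or.inr ENNReal.ofReal_ne_top)
    rw [mul_zero] at key2
    refine key2.congr' ?_
    filter_upwards [self_mem_nhdsWithin] with a ha
    rw [← eLpNorm_fourierIntegral_sub (integrable_indicator_exp_mul hf ha)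
      (memLp_indicator_exp_mul hf (le_of_lt ha))]
    refine eLpNorm_congr_ae ?_
    filter_upwards [hg] with η hη
    rw [hη, rayFourierIntegral, setIntegral_rayIntegrand_eq hζ _ _ measurableSet_Ioi]

/-- The `L²` Fourier transform on a ray is the limit of the truncated Fourier integrals. -/
theorem isRayFourierTransform_angularFourier (hζ : ζ * conj ζ = 1)
    (hf : MemLp (fun x : ℝ => f (onLine ζ x)) 2 (volume.restrict (Set.Ioi 0)))
    {u : Lp ℂ 2 (volume : Measure ℝ)}
    (hu : u =ᵐ[volume] (Set.Ioi 0).indicator fun x : ℝ => f (onLine ζ x)) {g : ℂ → ℂ}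
    (hg : ∀ᵐ η : ℝ, g (onLine (conj ζ) η) = angularFourier u η) :
    IsRayFourierTransform ζ f g := by
  set φ : ℝ → ℂ := fun x => f (onLine ζ x) with hφ
  have h0 : MemLp ((Set.Ioi 0).indicator φ) 2 volume :=
    (memLp_indicator_iff_restrict measurableSet_Ioi).mpr hf
  have hR2 : ∀ R : ℝ, MemLp ((Set.Ioc 0 R).indicator φ) 2 volume := fun R =>
    (memLp_indicator_iff_restrict measurableSet_Ioc).mpr
      (hf.mono_measure (Measure.restrict_mono Set.Ioc_subset_Ioi_self le_rfl))
  have hR1 : ∀ R : ℝ, Integrable ((Set.Ioc 0 R).indicator φ) := fun R => by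
    rw [integrable_indicator_iff measurableSet_Ioc]
    have := (memLp_indicator_iff_restrict measurableSet_Ioc).mp (hR2 R)
    exact this.integrable (by norm_num)
  have key : Tendsto (fun R : ℝ => eLpNorm (fun x => (Set.Ioc 0 R).indicator φ x - u x) 2 volume)
      atTop (𝓝 0) := by
    refine tendsto_eLpNorm_two_of_dominated
      (b := fun x => ‖(Set.Ioi 0).indicator φ x‖)
      (Eventually.of_forall fun R => (hR2 R).1.sub (Lp.memLp u).1) h0.norm ?_ ?_
    · refine Eventually.of_forall fun R => ?_
      filter_upwards [hu] with x hx
      rw [hx]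
      by_cases h1 : x ∈ Set.Ioi (0 : ℝ)
      · by_cases h2 : x ≤ R
        · rw [Set.indicator_of_mem (show x ∈ Set.Ioc 0 R from ⟨h1, h2⟩), Set.indicator_of_mem h1,
            sub_self, norm_zero]
          exact norm_nonneg _
        · rw [Set.indicator_of_notMem (fun h => h2 h.2), zero_sub, norm_neg]
      · rw [Set.indicator_of_notMem (fun h => h1 h.1), zero_sub, norm_neg]
    · filter_upwards [hu] with x hx
      rw [hx]
      refine tendsto_const_nhds.congr' ?_
      filter_upwards [eventually_ge_atTop x] with R hR
      by_cases h1 : x ∈ Set.Ioi (0 : ℝ)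
      · rw [Set.indicator_of_mem (show x ∈ Set.Ioc 0 R from ⟨h1, hR⟩), Set.indicator_of_mem h1,
          sub_self]
      · rw [Set.indicator_of_notMem (fun h => h1 h.1), Set.indicator_of_notMem h1, sub_self]
  have key2 := ENNReal.Tendsto.const_mul (a := ENNReal.ofReal (Real.sqrt (2 * Real.pi))) key
    (Or.inr ENNReal.ofReal_ne_top)
  rw [mul_zero] at key2
  refine key2.congr fun R => ?_
  rw [← eLpNorm_fourierIntegral_sub (hR1 R) (hR2 R)]
  refine eLpNorm_congr_ae ?_
  filter_upwards [hg] with η hη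
  have e := setIntegral_rayIntegrand_eq (f := f) hζ η 0 (measurableSet_Ioc (a := 0) (b := R))
  simp only [neg_zero, zero_mul, Real.exp_zero, Complex.ofReal_one, one_mul, Complex.ofReal_zero,
    mul_zero, sub_zero] at e
  rw [hη, onLine, mul_comm (η : ℂ), e]

end Ray

/-! ### Shifting the line of integration -/

theorem lintegral_enorm_mul_le {α : Type*} [MeasurableSpace α] {μ : Measure α} {f g : α → ℂ}
    (hf : AEStronglyMeasurable f μ) (hg : AEStronglyMeasurable g μ) :
    ∫⁻ x, ‖f x * g x‖ₑ ∂μ ≤ eLpNorm f 2 μ * eLpNorm g 2 μ := by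
  rw [← eLpNorm_one_eq_lintegral_enorm]
  have h : eLpNorm (f • g) 1 μ ≤ eLpNorm f 2 μ * eLpNorm g 2 μ :=
    eLpNorm_smul_le_mul_eLpNorm hg hf
  exact h

/-- The half-lines form a π-system generating the Borel sets. Closure under complements needs the
total integral to vanish, which follows by letting `t → ∞`. -/
theorem ae_eq_zero_of_forall_setIntegral_Iic {w : ℝ → ℂ} (hw : Integrable w)
    (h : ∀ t, ∫ x in Set.Iic t, w x = 0) : w =ᵐ[volume] 0 := by
  have htot : ∫ x, w x = 0 := by
    have h1 := (aecover_Iic (μ := (volume : Measure ℝ))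
      tendsto_id).integral_tendsto_of_countably_generated hw
    simp only [id, h] at h1
    exact (tendsto_nhds_unique h1 tendsto_const_nhds)
  suffices H : ∀ s, MeasurableSet s → ∫ x in s, w x = 0 from
    hw.ae_eq_zero_of_forall_setIntegral_eq_zero fun s hs _ => H s hs
  intro s hs
  induction s, hs using MeasurableSpace.induction_on_inter (borel_eq_generateFrom_Iic ℝ ▸
    BorelSpace.measurable_eq (α := ℝ)) isPiSystem_Iic with
  | empty => simp
  | basic t ht =>
    obtain ⟨x, rfl⟩ := ht
    exact h x
  | compl t ht ih =>
    have := integral_add_compl ht hw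
    rwa [ih, htot, zero_add] at this
  | iUnion f hd hf ih =>
    rw [integral_iUnion hf hd hw.integrableOn]
    simp only [ih, tsum_zero]

section Strip

variable {Φ : ℂ → ℂ}

theorem continuous_horizontal (hΦ : DifferentiableOn ℂ Φ {z | z.im < 0}) {y : ℝ} (hy : y < 0) :
    Continuous fun x : ℝ => Φ (x + y * Complex.I) :=
  hΦ.continuousOn.comp_continuous (by fun_prop) fun x => by simpa using hy

theorem integrable_horizontal (hΦ : DifferentiableOn ℂ Φ {z | z.im < 0}) {K : ℝ≥0∞} (hK : K ≠ ⊤)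
    (hb : ∀ y : ℝ, y < 0 → ∫⁻ x : ℝ, ‖Φ (x + y * Complex.I)‖ₑ ≤ K) {y : ℝ} (hy : y < 0) :
    Integrable fun x : ℝ => Φ (x + y * Complex.I) :=
  ⟨(continuous_horizontal hΦ hy).aestronglyMeasurable, (hb y hy).trans_lt hK.lt_top⟩

theorem aemeasurable_strip (hΦ : DifferentiableOn ℂ Φ {z | z.im < 0}) (p : ℝ) {q : ℝ}
    (hq : q < 0) :
    AEMeasurable (fun z : ℝ × ℝ => ‖Φ (z.1 + z.2 * Complex.I)‖ₑ)
      ((volume : Measure ℝ).prod (volume.restrict (Set.Ioc p q))) := by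
  have hc : ContinuousOn (fun z : ℝ × ℝ => Φ (z.1 + z.2 * Complex.I))
      (Set.univ ×ˢ Set.Ioc p q) :=
    hΦ.continuousOn.comp (by fun_prop) fun z hz => by simpa using hz.2.2.trans_lt hq
  have := (hc.aestronglyMeasurable (μ := (volume : Measure ℝ).prod volume)
    (MeasurableSet.univ.prod measurableSet_Ioc)).enorm
  rwa [← Measure.prod_restrict, Measure.restrict_univ] at this

/-- By Tonelli, the integral of `|Φ|` over the vertical segment at abscissa `x` is an integrable
function of `x`. -/
theorem lintegral_lintegral_strip_lt_top (hΦ : DifferentiableOn ℂ Φ {z | z.im < 0})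
    {K : ℝ≥0∞} (hK : K ≠ ⊤)
    (hb : ∀ y : ℝ, y < 0 → ∫⁻ x : ℝ, ‖Φ (x + y * Complex.I)‖ₑ ≤ K) (p : ℝ) {q : ℝ} (hq : q < 0) :
    ∫⁻ x : ℝ, ∫⁻ y in Set.Ioc p q, ‖Φ (x + y * Complex.I)‖ₑ < ⊤ := by
  rw [lintegral_lintegral_swap (aemeasurable_strip hΦ p hq)]
  calc ∫⁻ y in Set.Ioc p q, ∫⁻ x : ℝ, ‖Φ (x + y * Complex.I)‖ₑ
      ≤ ∫⁻ _ in Set.Ioc p q, K :=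
        setLIntegral_mono measurable_const fun y hy => hb y (hy.2.trans_lt hq)
    _ < ⊤ := by
        rw [setLIntegral_const, Real.volume_Ioc]
        exact ENNReal.mul_lt_top hK.lt_top ENNReal.ofReal_lt_top

/-- Cauchy's theorem on the rectangle `[-T,T] × [p,q]`: only the two vertical sides contribute to
the difference. -/
theorem enorm_integral_horizontal_sub_le (hΦ : DifferentiableOn ℂ Φ {z | z.im < 0}) {p q : ℝ}
    (hpq : p ≤ q) (hq : q < 0) (T : ℝ) :
    ‖(∫ x in -T..T, Φ (x + p * Complex.I)) - ∫ x in -T..T, Φ (x + q * Complex.I)‖ₑ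
      ≤ (∫⁻ y in Set.Ioc p q, ‖Φ (T + y * Complex.I)‖ₑ)
        + ∫⁻ y in Set.Ioc p q, ‖Φ ((-T : ℝ) + y * Complex.I)‖ₑ := by
  have h := Complex.integral_boundary_rect_eq_zero_of_differentiableOn Φ
    ((-T : ℝ) + p * Complex.I) (T + q * Complex.I) (hΦ.mono fun z hz => ?_)
  · simp only [Complex.add_re, Complex.ofReal_re, Complex.mul_re, Complex.I_re, mul_zero,
      Complex.ofReal_im, Complex.I_im, mul_one, sub_self, add_zero, Complex.add_im, Complex.mul_im,
      zero_add, smul_eq_mul] at h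
    have e : (∫ x in -T..T, Φ (x + p * Complex.I)) - ∫ x in -T..T, Φ (x + q * Complex.I)
        = Complex.I * (∫ y in p..q, Φ ((-T : ℝ) + y * Complex.I))
          - Complex.I * ∫ y in p..q, Φ (T + y * Complex.I) := by
      linear_combination h
    rw [e, add_comm]
    refine (enorm_sub_le).trans ?_
    simp only [enorm_mul, intervalIntegral.integral_of_le hpq]
    have hI : ‖Complex.I‖ₑ = 1 := by simp [← ofReal_norm]
    rw [hI, one_mul, one_mul]
    exact add_le_add (enorm_integral_le_lintegral_enorm _) (enorm_integral_le_lintegral_enorm _)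
  · have h2 := hz.2
    simp only [Complex.add_im, Complex.ofReal_im, Complex.mul_im, Complex.ofReal_re, Complex.I_im,
      mul_one, Complex.I_re, mul_zero, add_zero, zero_add, Set.mem_preimage,
      Set.uIcc_of_le hpq] at h2
    exact h2.2.trans_lt hq

/-- No pointwise decay of `Φ` is assumed, so the vertical sides are controlled on average. If the
two integrals differed, `V T + V (-T)` would exceed a fixed `ε > 0` for all large `T`, against its
integrability. -/
theorem integral_horizontal_eq_of_le (hΦ : DifferentiableOn ℂ Φ {z | z.im < 0})
    {K : ℝ≥0∞} (hK : K ≠ ⊤)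
    (hb : ∀ y : ℝ, y < 0 → ∫⁻ x : ℝ, ‖Φ (x + y * Complex.I)‖ₑ ≤ K) {p q : ℝ}
    (hpq : p ≤ q) (hq : q < 0) :
    ∫ x : ℝ, Φ (x + p * Complex.I) = ∫ x : ℝ, Φ (x + q * Complex.I) := by
  by_contra hne
  set V : ℝ → ℝ≥0∞ := fun T => ∫⁻ y in Set.Ioc p q, ‖Φ (T + y * Complex.I)‖ₑ with hV
  have hVfin : ∫⁻ T, V T < ⊤ := lintegral_lintegral_strip_lt_top hΦ hK hb p hq
  have hVneg : ∫⁻ T, V (-T) < ⊤ := by rwa [lintegral_neg_eq_self]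
  have hlim : Tendsto (fun T : ℝ => ‖(∫ x in -T..T, Φ (x + p * Complex.I))
      - ∫ x in -T..T, Φ (x + q * Complex.I)‖ₑ) atTop
      (𝓝 ‖(∫ x : ℝ, Φ (x + p * Complex.I)) - ∫ x : ℝ, Φ (x + q * Complex.I)‖ₑ) :=
    ((intervalIntegral_tendsto_integral (integrable_horizontal hΦ hK hb (hpq.trans_lt hq))
      tendsto_neg_atTop_atBot tendsto_id).sub
      (intervalIntegral_tendsto_integral (integrable_horizontal hΦ hK hb hq)
      tendsto_neg_atTop_atBot tendsto_id)).enorm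
  obtain ⟨ε, hε, hεl⟩ := exists_between (enorm_pos.mpr (sub_ne_zero.mpr hne))
  obtain ⟨T₀, hT₀⟩ := eventually_atTop.mp (hlim.eventually_const_lt hεl)
  have hbig : (⊤ : ℝ≥0∞) ≤ (∫⁻ T, V T) + ∫⁻ T, V (-T) := by
    calc (⊤ : ℝ≥0∞) = ∫⁻ _ in Set.Ici T₀, ε := by
          rw [setLIntegral_const, Real.volume_Ici, ENNReal.mul_top hε.ne']
      _ ≤ ∫⁻ T in Set.Ici T₀, (V T + V (-T)) := by
          refine setLIntegral_mono' measurableSet_Ici fun T hT => (hT₀ T hT).le.trans ?_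
          exact enorm_integral_horizontal_sub_le hΦ hpq hq T
      _ ≤ ∫⁻ T, (V T + V (-T)) := setLIntegral_le_lintegral _ _
      _ = _ := lintegral_add_left' (aemeasurable_strip hΦ p hq).lintegral_prod_right' _
  exact absurd hbig (not_le.mpr (ENNReal.add_lt_top.mpr ⟨hVfin, hVneg⟩))

/-- The integral of a holomorphic function over a horizontal line in the lower half-plane does not
depend on the line, if the `L¹` norms on these lines are bounded. -/
theorem integral_horizontal_eq (hΦ : DifferentiableOn ℂ Φ {z | z.im < 0})
    {K : ℝ≥0∞} (hK : K ≠ ⊤)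
    (hb : ∀ y : ℝ, y < 0 → ∫⁻ x : ℝ, ‖Φ (x + y * Complex.I)‖ₑ ≤ K) {p q : ℝ}
    (hp : p < 0) (hq : q < 0) :
    ∫ x : ℝ, Φ (x + p * Complex.I) = ∫ x : ℝ, Φ (x + q * Complex.I) := by
  rcases le_total p q with h | h
  · exact integral_horizontal_eq_of_le hΦ hK hb h hq
  · exact (integral_horizontal_eq_of_le hΦ hK hb h hp).symm

end Strip

/-! ### The Paley–Wiener theorem for the lower half-plane -/

/-- The Fourier transform of `x ↦ e^{x-t} 1_{x≤t}`, up to complex conjugation. -/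
noncomputable def paleyKernel (t : ℝ) (z : ℂ) : ℂ :=
  Complex.exp (Complex.I * z * t) / (1 + Complex.I * z)

theorem one_add_I_mul_ne_zero {z : ℂ} (hz : z.im ≤ 0) : 1 + Complex.I * z ≠ 0 := by
  intro h
  have := congrArg Complex.re h
  simp at this
  linarith

theorem differentiableAt_paleyKernel (t : ℝ) {z : ℂ} (hz : z.im ≤ 0) :
    DifferentiableAt ℂ (paleyKernel t) z := by
  unfold paleyKernel
  exact DifferentiableAt.div (by fun_prop) (by fun_prop) (one_add_I_mul_ne_zero hz)

theorem continuous_paleyKernel_horizontal (t : ℝ) {y : ℝ} (hy : y ≤ 0) :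
    Continuous fun x : ℝ => paleyKernel t (x + y * Complex.I) := by
  refine continuous_iff_continuousAt.mpr fun x => ?_
  have h : ContinuousAt (paleyKernel t) (x + y * Complex.I) :=
    (differentiableAt_paleyKernel t (by simpa using hy)).continuousAt
  exact h.comp (f := fun x : ℝ => (x + y * Complex.I : ℂ)) (by fun_prop)

/-- The sign of `t` enters here: `|e^{izt}| = e^{-yt} ≤ 1` when `t` and `y` are both nonpositive. -/
theorem norm_paleyKernel_le {t : ℝ} (ht : t ≤ 0) (x : ℝ) {y : ℝ} (hy : y ≤ 0) :
    ‖paleyKernel t (x + y * Complex.I)‖ ≤ ‖1 + Complex.I * (x + y * Complex.I)‖⁻¹ := by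
  rw [paleyKernel, norm_div, div_eq_mul_inv, Complex.norm_exp]
  refine mul_le_of_le_one_left (by positivity) (Real.exp_le_one_iff.mpr ?_)
  have : (Complex.I * (x + y * Complex.I) * t).re = -(y * t) := by simp
  rw [this]
  nlinarith

/-- Since `|1+iz|² = (1-y)² + x² ≥ 1 + x²`, this is a square integrable majorant independent of the
depth. -/
theorem norm_paleyKernel_le_inv_sqrt {t : ℝ} (ht : t ≤ 0) (x : ℝ) {y : ℝ} (hy : y ≤ 0) :
    ‖paleyKernel t (x + y * Complex.I)‖ ≤ (Real.sqrt (1 + x ^ 2))⁻¹ := by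
  refine (norm_paleyKernel_le ht x hy).trans ?_
  gcongr
  rw [Complex.norm_def]
  apply Real.sqrt_le_sqrt
  simp only [Complex.normSq_apply]
  simp
  nlinarith

/-- Keeping only the real part of `1+iz` gives pointwise decay as `y → -∞`. -/
theorem norm_paleyKernel_le_inv {t : ℝ} (ht : t ≤ 0) (x : ℝ) {y : ℝ} (hy : y ≤ 0) :
    ‖paleyKernel t (x + y * Complex.I)‖ ≤ (1 - y)⁻¹ := by
  refine (norm_paleyKernel_le ht x hy).trans ?_
  have h1 : 0 < 1 - y := by linarith
  gcongr
  refine le_trans (le_of_eq ?_) (Complex.re_le_norm _)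
  simp
  ring

theorem memLp_inv_sqrt_one_add_sq :
    MemLp (fun x : ℝ => (Real.sqrt (1 + x ^ 2))⁻¹) 2 volume := by
  have hm : Measurable fun x : ℝ => (Real.sqrt (1 + x ^ 2))⁻¹ := by fun_prop
  rw [memLp_two_iff_integrable_sq hm.aestronglyMeasurable]
  refine integrable_inv_one_add_sq.congr (Eventually.of_forall fun x => ?_)
  simp only [inv_pow]
  rw [Real.sq_sqrt (by positivity)]

theorem memLp_paleyKernel {t : ℝ} (ht : t ≤ 0) {y : ℝ} (hy : y ≤ 0) :
    MemLp (fun x : ℝ => paleyKernel t (x + y * Complex.I)) 2 volume :=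
  memLp_inv_sqrt_one_add_sq.mono' (continuous_paleyKernel_horizontal t hy).aestronglyMeasurable
    (Eventually.of_forall fun x => norm_paleyKernel_le_inv_sqrt ht x hy)

theorem tendsto_eLpNorm_paleyKernel_atBot {t : ℝ} (ht : t ≤ 0) :
    Tendsto (fun y : ℝ => eLpNorm (fun x : ℝ => paleyKernel t (x + y * Complex.I)) 2 volume)
      atBot (𝓝 0) := by
  refine tendsto_eLpNorm_two_of_dominated ?_ memLp_inv_sqrt_one_add_sq ?_ ?_
  · filter_upwards [eventually_le_atBot 0] with y hy using (memLp_paleyKernel ht hy).1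
  · filter_upwards [eventually_le_atBot 0] with y hy
    exact Eventually.of_forall fun x => norm_paleyKernel_le_inv_sqrt ht x hy
  · refine Eventually.of_forall fun x => ?_
    have h : Tendsto (fun y : ℝ => (1 - y)⁻¹) atBot (𝓝 0) :=
      tendsto_inv_atTop_zero.comp
        (tendsto_atTop_add_const_left atBot 1 tendsto_neg_atBot_atTop)
    refine squeeze_zero_norm' ?_ h
    filter_upwards [eventually_le_atBot 0] with y hy using norm_paleyKernel_le_inv ht x hy

theorem tendsto_eLpNorm_paleyKernel_sub {t : ℝ} (ht : t ≤ 0) :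
    Tendsto (fun y : ℝ => eLpNorm (fun x : ℝ => paleyKernel t (x + y * Complex.I)
      - paleyKernel t x) 2 volume) (𝓝[<] 0) (𝓝 0) := by
  have h0 : ∀ x : ℝ, paleyKernel t x = paleyKernel t (x + (0 : ℝ) * Complex.I) := fun x => by simp
  refine tendsto_eLpNorm_two_of_dominated (b := fun x => 2 * (Real.sqrt (1 + x ^ 2))⁻¹) ?_
    (memLp_inv_sqrt_one_add_sq.const_mul 2) ?_ ?_
  · filter_upwards [self_mem_nhdsWithin] with y hy
    simp only [h0]
    exact (memLp_paleyKernel ht (le_of_lt hy)).1.sub (memLp_paleyKernel ht le_rfl).1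
  · filter_upwards [self_mem_nhdsWithin] with y hy
    refine Eventually.of_forall fun x => (norm_sub_le _ _).trans ?_
    rw [two_mul, h0 x]
    exact add_le_add (norm_paleyKernel_le_inv_sqrt ht x (le_of_lt hy))
      (norm_paleyKernel_le_inv_sqrt ht x le_rfl)
  · refine Eventually.of_forall fun x => Tendsto.mono_left ?_ nhdsWithin_le_nhds
    have hc : ContinuousAt (paleyKernel t) (x + (0 : ℝ) * Complex.I) :=
      (differentiableAt_paleyKernel t (by simp)).continuousAt
    have hc2 : ContinuousAt (fun y : ℝ => paleyKernel t (x + y * Complex.I)) 0 :=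
      hc.comp (f := fun y : ℝ => (x + y * Complex.I : ℂ)) (by fun_prop)
    have := hc2.tendsto.sub_const (paleyKernel t x)
    rwa [← h0 x, sub_self] at this

/-! ### Vanishing pairings of Hardy functions with the kernels -/

section Hardy

variable {H : ℂ → ℂ} {C : ℝ≥0}

theorem lintegral_enorm_paleyKernel_mul_le (hH : DifferentiableOn ℂ H {z | z.im < 0})
    (hC : ∀ y : ℝ, y < 0 → eLpNorm (fun x : ℝ => H (x + y * Complex.I)) 2 volume ≤ C)
    {t : ℝ} (ht : t ≤ 0) {y : ℝ} (hy : y < 0) :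
    ∫⁻ x : ℝ, ‖paleyKernel t (x + y * Complex.I) * H (x + y * Complex.I)‖ₑ
      ≤ eLpNorm (fun x : ℝ => paleyKernel t (x + y * Complex.I)) 2 volume * C :=
  (lintegral_enorm_mul_le (memLp_paleyKernel ht hy.le).1
    (continuous_horizontal hH hy).aestronglyMeasurable).trans (mul_le_mul_right (hC y hy) _)

/-- The integral does not depend on the height, and by Cauchy–Schwarz it is at most `C` times the
`L²` norm of the kernel, which tends to zero at infinite depth. -/
theorem integral_paleyKernel_mul_horizontal (hH : DifferentiableOn ℂ H {z | z.im < 0})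
    (hC : ∀ y : ℝ, y < 0 → eLpNorm (fun x : ℝ => H (x + y * Complex.I)) 2 volume ≤ C)
    {t : ℝ} (ht : t ≤ 0) {y : ℝ} (hy : y < 0) :
    ∫ x : ℝ, paleyKernel t (x + y * Complex.I) * H (x + y * Complex.I) = 0 := by
  have hΦ : DifferentiableOn ℂ (fun z => paleyKernel t z * H z) {z | z.im < 0} :=
    DifferentiableOn.mul (fun z hz => (differentiableAt_paleyKernel t
      (le_of_lt hz)).differentiableWithinAt) hH
  have hK : eLpNorm (fun x : ℝ => (Real.sqrt (1 + x ^ 2))⁻¹) 2 volume * C ≠ ⊤ :=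
    ENNReal.mul_ne_top memLp_inv_sqrt_one_add_sq.eLpNorm_ne_top ENNReal.coe_ne_top
  have hb : ∀ y : ℝ, y < 0 →
      ∫⁻ x : ℝ, ‖paleyKernel t (x + y * Complex.I) * H (x + y * Complex.I)‖ₑ
        ≤ eLpNorm (fun x : ℝ => (Real.sqrt (1 + x ^ 2))⁻¹) 2 volume * C := fun y hy =>
    (lintegral_enorm_paleyKernel_mul_le hH hC ht hy).trans (mul_le_mul_left
      (eLpNorm_mono_real fun x => norm_paleyKernel_le_inv_sqrt ht x hy.le) _)
  have hlim : Tendsto (fun s : ℝ =>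
      eLpNorm (fun x : ℝ => paleyKernel t (x + s * Complex.I)) 2 volume * C) atBot (𝓝 0) := by
    have := ENNReal.Tendsto.mul_const (b := (C : ℝ≥0∞)) (tendsto_eLpNorm_paleyKernel_atBot ht)
      (Or.inr ENNReal.coe_ne_top)
    rwa [zero_mul] at this
  rw [← enorm_eq_zero, ← nonpos_iff_eq_zero]
  refine ge_of_tendsto hlim ?_
  filter_upwards [eventually_lt_atBot 0] with s hs
  rw [integral_horizontal_eq hΦ hK hb hy hs]
  exact (enorm_integral_le_lintegral_enorm _).trans
    (lintegral_enorm_paleyKernel_mul_le hH hC ht hs)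

theorem integral_paleyKernel_mul_boundary (hH : DifferentiableOn ℂ H {z | z.im < 0})
    (hC : ∀ y : ℝ, y < 0 → eLpNorm (fun x : ℝ => H (x + y * Complex.I)) 2 volume ≤ C)
    {v : ℝ → ℂ} (hv : MemLp v 2 volume)
    (hlim : Tendsto (fun y : ℝ => eLpNorm (fun x : ℝ => H (x + y * Complex.I) - v x) 2 volume)
      (𝓝[<] 0) (𝓝 0)) {t : ℝ} (ht : t ≤ 0) :
    ∫ x : ℝ, paleyKernel t x * v x = 0 := by
  have h0 : ∀ x : ℝ, paleyKernel t x = paleyKernel t (x + (0 : ℝ) * Complex.I) := fun x => by simp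
  have hm0 : MemLp (fun x : ℝ => paleyKernel t x) 2 volume := by
    simp only [h0]
    exact memLp_paleyKernel ht le_rfl
  set B := eLpNorm (fun x : ℝ => (Real.sqrt (1 + x ^ 2))⁻¹) 2 volume
  have hB : B ≠ ⊤ := memLp_inv_sqrt_one_add_sq.eLpNorm_ne_top
  have l1 := ENNReal.Tendsto.const_mul hlim (Or.inr hB)
  have l2 := ENNReal.Tendsto.mul_const (tendsto_eLpNorm_paleyKernel_sub ht)
    (Or.inr hv.eLpNorm_ne_top)
  have l3 := l1.add l2
  rw [mul_zero, zero_mul, add_zero] at l3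
  rw [← enorm_eq_zero, ← nonpos_iff_eq_zero]
  refine ge_of_tendsto l3 ?_
  filter_upwards [self_mem_nhdsWithin] with y hy
  have hy : y < 0 := hy
  have mK := memLp_paleyKernel ht hy.le
  have mH : MemLp (fun x : ℝ => H (x + y * Complex.I)) 2 volume :=
    ⟨(continuous_horizontal hH hy).aestronglyMeasurable, (hC y hy).trans_lt ENNReal.coe_lt_top⟩
  have e : ∫ x : ℝ, paleyKernel t x * v x =
      ∫ x : ℝ, (paleyKernel t x * v x
        - paleyKernel t (x + y * Complex.I) * H (x + y * Complex.I)) := by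
    have i1 : Integrable fun x : ℝ => paleyKernel t x * v x := hm0.integrable_mul hv
    have i2 : Integrable fun x : ℝ =>
        paleyKernel t (x + y * Complex.I) * H (x + y * Complex.I) := mK.integrable_mul mH
    rw [integral_sub i1 i2,
      integral_paleyKernel_mul_horizontal hH hC ht hy, sub_zero]
  rw [e]
  calc _ ≤ ∫⁻ x : ℝ, ‖paleyKernel t x * v x
          - paleyKernel t (x + y * Complex.I) * H (x + y * Complex.I)‖ₑ :=
        enorm_integral_le_lintegral_enorm _
    -- Up to sign, `k v - k_y H_y` is `k_y (H_y - v) + (k_y - k) v`; each product has one factor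
    -- small in `L²` and the other bounded there.
    _ ≤ ∫⁻ x : ℝ, (‖paleyKernel t (x + y * Complex.I) * (H (x + y * Complex.I) - v x)‖ₑ
          + ‖(paleyKernel t (x + y * Complex.I) - paleyKernel t x) * v x‖ₑ) := by
        refine lintegral_mono fun x => ?_
        refine le_trans (le_of_eq ?_) (enorm_add_le _ _)
        rw [← enorm_neg]
        congr 1
        ring
    _ = _ := lintegral_add_left' (mK.1.mul (mH.1.sub hv.1)).enorm _
    _ ≤ _ := by
        refine add_le_add ?_ ?_
        · refine (lintegral_enorm_mul_le mK.1 (mH.1.sub hv.1)).trans (mul_le_mul_left ?_ _)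
          exact eLpNorm_mono_real fun x => norm_paleyKernel_le_inv_sqrt ht x hy.le
        · exact lintegral_enorm_mul_le (mK.1.sub hm0.1) hv.1

end Hardy

theorem memLp_indicator_Iic_exp_sub (t : ℝ) :
    MemLp ((Set.Iic t).indicator fun x : ℝ => ((Real.exp (x - t) : ℝ) : ℂ)) 2 volume := by
  rw [memLp_indicator_iff_restrict measurableSet_Iic]
  suffices h : MemLp (fun x : ℝ => Real.exp (x - t)) 2 (volume.restrict (Set.Iic t)) from h.ofReal
  rw [memLp_two_iff_integrable_sq (by fun_prop)]
  refine ((integrableOn_exp_mul_Iic (a := 2) (by norm_num) t).const_mul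
    (Real.exp (-(2 * t)))).congr (Eventually.of_forall fun x => ?_)
  beta_reduce
  rw [← Real.exp_nat_mul, ← Real.exp_add]
  congr 1
  push_cast
  ring

theorem integrable_indicator_Iic_exp_sub (t : ℝ) :
    Integrable ((Set.Iic t).indicator fun x : ℝ => ((Real.exp (x - t) : ℝ) : ℂ)) := by
  rw [integrable_indicator_iff measurableSet_Iic]
  suffices h : IntegrableOn (fun x : ℝ => Real.exp (x - t)) (Set.Iic t) from h.ofReal
  refine ((integrableOn_exp_mul_Iic (a := 1) (by norm_num) t).const_mul
    (Real.exp (-t))).congr (Eventually.of_forall fun x => ?_)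
  simp only [← Real.exp_add]
  congr 1
  ring

/-- The conjugate appears because the inner product is conjugate-linear in its first argument, where
the test function stands. -/
theorem conj_integral_exp_mul_indicator_Iic (t η : ℝ) :
    conj (∫ x : ℝ, Complex.exp (-(Complex.I * η * x)) *
      (Set.Iic t).indicator (fun x : ℝ => ((Real.exp (x - t) : ℝ) : ℂ)) x) = paleyKernel t η := by
  have e : ∫ x : ℝ, Complex.exp (-(Complex.I * η * x)) *
      (Set.Iic t).indicator (fun x : ℝ => ((Real.exp (x - t) : ℝ) : ℂ)) x
      = ∫ x in Set.Iic t, Complex.exp (-t) * Complex.exp ((1 - Complex.I * η) * x) := by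
    rw [← integral_indicator measurableSet_Iic]
    refine integral_congr_ae (Eventually.of_forall fun x => ?_)
    by_cases hx : x ∈ Set.Iic t
    · simp only [Set.indicator_of_mem hx]
      rw [Complex.ofReal_exp, ← Complex.exp_add, ← Complex.exp_add]
      congr 1
      push_cast
      ring
    · simp only [Set.indicator_of_notMem hx, mul_zero]
  rw [e, integral_const_mul, integral_exp_mul_complex_Iic (by simp), paleyKernel, mul_div_assoc',
    ← Complex.exp_add, map_div₀, ← Complex.exp_conj]
  simp only [map_add, map_neg, map_mul, map_sub, map_one, Complex.conj_ofReal, Complex.conj_I]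
  congr 1
  · congr 1
    ring
  · ring

/-- **Paley–Wiener**: the `L²` boundary values of a Hardy function of the lower half-plane are the
Fourier transform of a function vanishing on the negative half-line. -/
theorem angularFourier_symm_ae_eq_zero {H : ℂ → ℂ} {C : ℝ≥0}
    (hH : DifferentiableOn ℂ H {z | z.im < 0})
    (hC : ∀ y : ℝ, y < 0 → eLpNorm (fun x : ℝ => H (x + y * Complex.I)) 2 volume ≤ C)
    {v : Lp ℂ 2 (volume : Measure ℝ)}
    (hlim : Tendsto (fun y : ℝ => eLpNorm (fun x : ℝ => H (x + y * Complex.I) - v x) 2 volume)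
      (𝓝[<] 0) (𝓝 0)) :
    ∀ᵐ x : ℝ, x ≤ 0 → angularFourier.symm v x = 0 := by
  set u := angularFourier.symm v with hu
  have hint : ∀ t : ℝ, IntegrableOn (fun x : ℝ => ((Real.exp x : ℝ) : ℂ) * u x) (Set.Iic t) := by
    intro t
    have h := ((memLp_indicator_Iic_exp_sub t).integrable_mul (Lp.memLp u)).const_mul
      (Real.exp t : ℂ)
    rw [← integrable_indicator_iff measurableSet_Iic]
    refine h.congr (Eventually.of_forall fun x => ?_)
    by_cases hx : x ∈ Set.Iic t
    · simp only [Pi.mul_apply, Set.indicator_of_mem hx]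
      rw [← mul_assoc, ← Complex.ofReal_mul, ← Real.exp_add, add_sub_cancel]
    · simp only [Pi.mul_apply, Set.indicator_of_notMem hx, mul_zero, zero_mul]
  have hzero : ∀ t : ℝ, t ≤ 0 → ∫ x in Set.Iic t, ((Real.exp x : ℝ) : ℂ) * u x = 0 := by
    intro t ht
    have h1 := integral_paleyKernel_mul_boundary hH hC (Lp.memLp v) hlim ht
    set k := (memLp_indicator_Iic_exp_sub t).toLp _ with hk
    -- In this identity the left side is the vanishing kernel pairing with `v`, and the right side
    -- is `2π e^{-t}` times the wanted integral.
    have h2 := inner_angularFourier k u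
    rw [hu, LinearEquiv.apply_symm_apply, L2.inner_def, L2.inner_def] at h2
    have h3 : ∫ η : ℝ, inner ℂ (angularFourier k η) (v η) = ∫ η : ℝ, paleyKernel t η * v η := by
      refine integral_congr_ae ?_
      filter_upwards [coeFn_angularFourier_ae_eq (integrable_indicator_Iic_exp_sub t)
        (memLp_indicator_Iic_exp_sub t)] with η hη
      rw [hη, RCLike.inner_apply', ← conj_integral_exp_mul_indicator_Iic]
    have h4 : ∫ x : ℝ, inner ℂ (k x) (u x)
        = (Real.exp (-t) : ℂ) * ∫ x in Set.Iic t, ((Real.exp x : ℝ) : ℂ) * u x := by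
      rw [← integral_const_mul, ← integral_indicator measurableSet_Iic]
      refine integral_congr_ae ?_
      filter_upwards [(memLp_indicator_Iic_exp_sub t).coeFn_toLp] with x hx
      rw [hk, hx, RCLike.inner_apply']
      by_cases hx : x ∈ Set.Iic t
      · simp only [Set.indicator_of_mem hx]
        rw [Complex.conj_ofReal, ← mul_assoc, ← Complex.ofReal_mul, ← Real.exp_add, neg_add_eq_sub]
      · simp only [Set.indicator_of_notMem hx, map_zero, zero_mul]
    rw [h3, h1, ← hu, h4] at h2
    have hpi : (2 * (Real.pi : ℂ)) ≠ 0 := by exact_mod_cast Real.two_pi_pos.ne'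
    have hexp : (Real.exp (-t) : ℂ) ≠ 0 := by exact_mod_cast (Real.exp_pos (-t)).ne'
    simpa [hpi, hexp] using h2.symm
  -- Cutting off to `(-∞,0]` replaces an arbitrary `t` by `min t 0`, to which `hzero` applies.
  have hw := ae_eq_zero_of_forall_setIntegral_Iic
    ((integrable_indicator_iff measurableSet_Iic).mpr (hint 0)) (fun t => by
      rw [setIntegral_indicator measurableSet_Iic, Set.Iic_inter_Iic]
      exact hzero _ (min_le_right _ _))
  filter_upwards [hw] with x hx hx0
  rw [Set.indicator_of_mem (show x ∈ Set.Iic (0 : ℝ) from hx0), Pi.zero_apply] at hx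
  exact (mul_eq_zero.mp hx).resolve_left (by exact_mod_cast (Real.exp_pos x).ne')

/-! ### Functions on three lines or rays as triples of functions on the real line -/

theorem zeta_re (k : Fin 3) : (zeta k).re = ![1, -1 / 2, -1 / 2] k := by
  fin_cases k <;> simp [zeta]

theorem zeta_im (k : Fin 3) :
    (zeta k).im = ![0, Real.sqrt 3 / 2, -Real.sqrt 3 / 2] k := by
  fin_cases k <;> simp [zeta]

theorem zeta_mul_conj (k : Fin 3) : zeta k * conj (zeta k) = 1 := by
  have h3 : Real.sqrt 3 * Real.sqrt 3 = 3 := Real.mul_self_sqrt (by norm_num)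
  rw [Complex.mul_conj, Complex.normSq_apply, zeta_re, zeta_im, ← Complex.ofReal_one]
  congr 1
  fin_cases k <;> simp <;> linarith

/-- This says that distinct lines are transversal: `xζₖ` lies on the `j`-th line exactly when `x ·
Im(ζₖ conj ζⱼ) = 0`. -/
theorem im_zeta_mul_conj_ne_zero {k j : Fin 3} (h : k ≠ j) : (zeta k * conj (zeta j)).im ≠ 0 := by
  have h3 : 0 < Real.sqrt 3 := Real.sqrt_pos.mpr (by norm_num)
  rw [Complex.mul_im, Complex.conj_re, Complex.conj_im, zeta_re, zeta_re, zeta_im, zeta_im]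
  fin_cases k <;> fin_cases j <;> simp at h ⊢ <;> intro h <;> linarith

/-- Complex conjugation of the indices of the three cube roots of unity. -/
def conjIndex : Equiv.Perm (Fin 3) := Equiv.swap 1 2

theorem conjIndex_conjIndex (k : Fin 3) : conjIndex (conjIndex k) = k :=
  Equiv.swap_apply_self 1 2 k

theorem conj_zeta (k : Fin 3) : conj (zeta k) = zeta (conjIndex k) := by
  apply Complex.ext
  · rw [Complex.conj_re, zeta_re, zeta_re]
    fin_cases k <;> simp [conjIndex, Equiv.swap_apply_def]
  · rw [Complex.conj_im, zeta_im, zeta_im]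
    fin_cases k <;> simp [conjIndex, Equiv.swap_apply_def] <;> ring

/-- The sum of the push-forwards of a measure on `ℝ` to the three lines. -/
noncomputable def bundleMeasure (ν : Measure ℝ) : Measure ℂ :=
  ∑ k : Fin 3, Measure.map (onLine (zeta k)) ν

/-- The function on the plane with prescribed values on the three lines. -/
noncomputable def glue (u : Fin 3 → ℝ → ℂ) (w : ℂ) : ℂ :=
  ∑ k : Fin 3, {w : ℂ | (w * conj (zeta k)).im = 0}.indicator
    (fun w => u k (w * conj (zeta k)).re) w

theorem measurable_glue {u : Fin 3 → ℝ → ℂ} (hu : ∀ k, Measurable (u k)) :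
    Measurable (glue u) := by
  refine Finset.measurable_sum _ fun k _ => Measurable.indicator ?_ ?_
  · exact (hu k).comp (by fun_prop)
  · exact measurableSet_eq_fun (by fun_prop) measurable_const

/-- Away from the origin a single summand survives; at `x = 0` all three contribute. -/
theorem glue_onLine (u : Fin 3 → ℝ → ℂ) (k : Fin 3) {x : ℝ} (hx : x ≠ 0) :
    glue u (onLine (zeta k) x) = u k x := by
  rw [glue, Finset.sum_eq_single k]
  · have e : onLine (zeta k) x * conj (zeta k) = x := by
      rw [onLine, mul_assoc, zeta_mul_conj, mul_one]
    have hm : onLine (zeta k) x ∈ {w : ℂ | (w * conj (zeta k)).im = 0} := by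
      rw [Set.mem_ofPred_eq, e, Complex.ofReal_im]
    rw [Set.indicator_of_mem hm, e, Complex.ofReal_re]
  · intro j _ hj
    refine Set.indicator_of_notMem ?_ _
    rw [Set.mem_ofPred_eq, onLine, mul_assoc, Complex.im_ofReal_mul]
    exact mul_ne_zero hx (im_zeta_mul_conj_ne_zero hj.symm)
  · simp

/-! ### `L²` of a bundle as a triple of `L²` spaces, for `ν` Lebesgue measure on `ℝ` or on `[0,∞)`
-/

section Bundle

variable {ν : Measure ℝ}

theorem ae_bundleMeasure_iff {p : ℂ → Prop} (hp : MeasurableSet {w | p w}) :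
    (∀ᵐ w ∂bundleMeasure ν, p w) ↔ ∀ k, ∀ᵐ x ∂ν, p (onLine (zeta k) x) := by
  simp only [bundleMeasure, ae_finsetSum_measure_iff, Finset.mem_univ, true_imp_iff]
  exact forall_congr' fun k => ae_map_iff (measurable_onLine _).aemeasurable hp

theorem map_onLine_le_bundleMeasure (k : Fin 3) :
    Measure.map (onLine (zeta k)) ν ≤ bundleMeasure ν :=
  Finset.single_le_sum (f := fun k => Measure.map (onLine (zeta k)) ν)
    (fun _ _ => Measure.zero_le _) (Finset.mem_univ k)

theorem ae_onLine_of_ae_bundleMeasure {p : ℂ → Prop} (h : ∀ᵐ w ∂bundleMeasure ν, p w)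
    (k : Fin 3) : ∀ᵐ x ∂ν, p (onLine (zeta k) x) :=
  ae_of_ae_map (measurable_onLine _).aemeasurable (ae_mono (map_onLine_le_bundleMeasure k) h)

theorem memLp_comp_onLine {g : ℂ → ℂ} (hg : MemLp g 2 (bundleMeasure ν)) (k : Fin 3) :
    MemLp (fun x => g (onLine (zeta k) x)) 2 ν :=
  (hg.mono_measure (map_onLine_le_bundleMeasure k)).comp_of_map (measurable_onLine _).aemeasurable

theorem integrable_bundleMeasure {g : ℂ → ℝ} (hg : Measurable g)
    (h : ∀ k, Integrable (fun x => g (onLine (zeta k) x)) ν) :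
    Integrable g (bundleMeasure ν) := by
  rw [bundleMeasure, integrable_finsetSum_measure]
  exact fun k _ => (integrable_map_measure hg.aestronglyMeasurable
    (measurable_onLine _).aemeasurable).mpr (h k)

theorem integral_bundleMeasure {g : ℂ → ℂ} (hg : Integrable g (bundleMeasure ν)) :
    ∫ w, g w ∂bundleMeasure ν = ∑ k, ∫ x, g (onLine (zeta k) x) ∂ν := by
  have hk : ∀ k, Integrable g (Measure.map (onLine (zeta k)) ν) := fun k =>
    hg.mono_measure (map_onLine_le_bundleMeasure k)
  rw [bundleMeasure, integral_finsetSum_measure fun k _ => hk k]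
  exact Finset.sum_congr rfl fun k _ =>
    integral_map (measurable_onLine _).aemeasurable (hk k).1

theorem memLp_glue (hν : ∀ᵐ x ∂ν, x ≠ 0) {u : Fin 3 → ℝ → ℂ} (hm : ∀ k, Measurable (u k))
    (hu : ∀ k, MemLp (u k) 2 ν) : MemLp (glue u) 2 (bundleMeasure ν) := by
  rw [memLp_two_iff_integrable_sq_norm (measurable_glue hm).aestronglyMeasurable]
  refine integrable_bundleMeasure ((measurable_glue hm).norm.pow_const 2) fun k => ?_
  refine ((memLp_two_iff_integrable_sq_norm (hu k).1).mp (hu k)).congr ?_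
  filter_upwards [hν] with x hx
  rw [glue_onLine u k hx]

/-- The restrictions of a function to the three lines. -/
noncomputable def bundleRestrict (ν : Measure ℝ) :
    Lp ℂ 2 (bundleMeasure ν) →ₗ[ℂ] (Fin 3 → Lp ℂ 2 ν) where
  toFun g k := (memLp_comp_onLine (Lp.memLp g) k).toLp _
  map_add' g h := by
    funext k
    rw [Pi.add_apply, ← MemLp.toLp_add]
    exact MemLp.toLp_congr _ _ (ae_onLine_of_ae_bundleMeasure (Lp.coeFn_add g h) k)
  map_smul' c g := by
    funext k
    rw [Pi.smul_apply, RingHom.id_apply, ← MemLp.toLp_const_smul]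
    exact MemLp.toLp_congr _ _ (ae_onLine_of_ae_bundleMeasure (Lp.coeFn_smul c g) k)

theorem coeFn_bundleRestrict (g : Lp ℂ 2 (bundleMeasure ν)) (k : Fin 3) :
    bundleRestrict ν g k =ᵐ[ν] fun x => g (onLine (zeta k) x) :=
  (memLp_comp_onLine (Lp.memLp g) k).coeFn_toLp

theorem bundleRestrict_injective : Function.Injective (bundleRestrict ν) := by
  intro g h hgh
  apply Lp.ext
  refine (ae_bundleMeasure_iff ?_).mpr fun k => ?_
  · exact measurableSet_eq_fun (Lp.stronglyMeasurable g).measurable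
      (Lp.stronglyMeasurable h).measurable
  · have h1 := coeFn_bundleRestrict h k
    rw [← hgh] at h1
    exact (coeFn_bundleRestrict g k).symm.trans h1

theorem bundleRestrict_surjective (hν : ∀ᵐ x ∂ν, x ≠ 0) :
    Function.Surjective (bundleRestrict ν) := by
  intro u
  have hm := memLp_glue hν (fun k => (Lp.stronglyMeasurable (u k)).measurable)
    (fun k => Lp.memLp (u k))
  refine ⟨hm.toLp _, funext fun k => Lp.ext ?_⟩
  filter_upwards [hν, coeFn_bundleRestrict (hm.toLp _) k,
    ae_onLine_of_ae_bundleMeasure hm.coeFn_toLp k] with x h1 h2 h3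
  rw [h2, h3, glue_onLine _ _ h1]

theorem inner_bundleRestrict (g h : Lp ℂ 2 (bundleMeasure ν)) :
    inner ℂ g h = ∑ k, inner ℂ (bundleRestrict ν g k) (bundleRestrict ν h k) := by
  rw [L2.inner_def, integral_bundleMeasure (L2.integrable_inner g h)]
  refine Finset.sum_congr rfl fun k _ => ?_
  rw [L2.inner_def]
  refine integral_congr_ae ?_
  filter_upwards [coeFn_bundleRestrict g k, coeFn_bundleRestrict h k] with x h1 h2
  rw [h1, h2]

end Bundle

/-! ### The transform on the whole bundle -/

/-- Extension by zero from the half-line to the real line. -/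
noncomputable def extendZero :
    Lp ℂ 2 (volume.restrict (Set.Ici (0 : ℝ))) →ₗ[ℂ] Lp ℂ 2 (volume : Measure ℝ) where
  toFun u := ((memLp_indicator_iff_restrict measurableSet_Ici).mpr (Lp.memLp u)).toLp
    ((Set.Ici 0).indicator u)
  map_add' u v := by
    rw [← MemLp.toLp_add, MemLp.toLp_eq_toLp_iff, ← Set.indicator_add']
    exact (ae_eq_restrict_iff_indicator_ae_eq measurableSet_Ici).mp (Lp.coeFn_add u v)
  map_smul' c u := by
    rw [RingHom.id_apply, ← MemLp.toLp_const_smul, MemLp.toLp_eq_toLp_iff]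
    refine ((ae_eq_restrict_iff_indicator_ae_eq measurableSet_Ici).mp
      (Lp.coeFn_smul c u)).trans (Eventually.of_forall fun x => ?_)
    exact Set.indicator_const_smul_apply _ c u x

theorem coeFn_extendZero (u : Lp ℂ 2 (volume.restrict (Set.Ici (0 : ℝ)))) :
    extendZero u =ᵐ[volume] (Set.Ici 0).indicator u :=
  ((memLp_indicator_iff_restrict measurableSet_Ici).mpr (Lp.memLp u)).coeFn_toLp

theorem inner_extendZero (u v : Lp ℂ 2 (volume.restrict (Set.Ici (0 : ℝ)))) :
    inner ℂ (extendZero u) (extendZero v) = inner ℂ u v := by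
  rw [L2.inner_def, L2.inner_def, ← integral_indicator measurableSet_Ici]
  refine integral_congr_ae ?_
  filter_upwards [coeFn_extendZero u, coeFn_extendZero v] with x h1 h2
  rw [h1, h2]
  by_cases hx : x ∈ Set.Ici (0 : ℝ)
  · simp only [Set.indicator_of_mem hx]
  · simp only [Set.indicator_of_notMem hx, inner_zero_left]

theorem exists_extendZero_eq {v : Lp ℂ 2 (volume : Measure ℝ)}
    (hv : ∀ᵐ x : ℝ, x ≤ 0 → v x = 0) : ∃ u, extendZero u = v := by
  have hr : MemLp v 2 (volume.restrict (Set.Ici (0 : ℝ))) := (Lp.memLp v).restrict _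
  refine ⟨hr.toLp _, Lp.ext ?_⟩
  filter_upwards [hv, coeFn_extendZero (hr.toLp _),
    (ae_restrict_iff' measurableSet_Ici).mp hr.coeFn_toLp] with x h1 h2 h3
  rw [h2]
  by_cases hx : x ∈ Set.Ici (0 : ℝ)
  · rw [Set.indicator_of_mem hx, h3 hx]
  · rw [Set.indicator_of_notMem hx, h1 (le_of_lt (not_le.mp hx))]

/-- The Fourier transform from functions on the three rays to functions on the three lines. -/
noncomputable def bundleFourier : L2Rays →ₗ[ℂ] L2Lines :=
  (LinearEquiv.ofBijective (bundleRestrict volume)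
    ⟨bundleRestrict_injective, bundleRestrict_surjective (Measure.ae_ne volume 0)⟩).symm.toLinearMap
  ∘ₗ LinearMap.pi fun k => angularFourier.toLinearMap ∘ₗ extendZero ∘ₗ
    -- The transform along a ray lives on the conjugate line, so line `k` receives the ray of index
    -- `conjIndex k`.
    LinearMap.proj (conjIndex k) ∘ₗ bundleRestrict (volume.restrict (Set.Ici 0))

theorem bundleRestrict_bundleFourier (f : L2Rays) (k : Fin 3) :
    bundleRestrict volume (bundleFourier f) k =
      angularFourier (extendZero (bundleRestrict (volume.restrict (Set.Ici 0)) f (conjIndex k))) :=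
  congrFun ((LinearEquiv.ofBijective (bundleRestrict volume)
    ⟨bundleRestrict_injective, bundleRestrict_surjective
      (Measure.ae_ne volume 0)⟩).apply_symm_apply _) k

theorem inner_bundleFourier (f g : L2Rays) :
    inner ℂ (bundleFourier f) (bundleFourier g) = 2 * (Real.pi : ℂ) * inner ℂ f g := by
  -- `linesMeasure` and `raysMeasure` unfold to `bundleMeasure ν` for these two choices of `ν`.
  have h1 := inner_bundleRestrict (ν := volume) (bundleFourier f) (bundleFourier g)
  have h2 := inner_bundleRestrict (ν := volume.restrict (Set.Ici 0)) f g
  refine h1.trans ?_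
  refine Eq.trans ?_ (congrArg (fun z => 2 * (Real.pi : ℂ) * z) h2.symm)
  rw [Finset.mul_sum, ← Equiv.sum_comp conjIndex]
  refine Finset.sum_congr rfl fun k _ => ?_
  rw [bundleRestrict_bundleFourier, bundleRestrict_bundleFourier, inner_angularFourier,
    inner_extendZero, conjIndex_conjIndex]

section Components

variable (f : L2Rays) (k : Fin 3)

theorem memLp_rayComponent :
    MemLp (fun x : ℝ => f (onLine (zeta k) x)) 2 (volume.restrict (Set.Ioi 0)) :=
  (memLp_comp_onLine (ν := volume.restrict (Set.Ici 0)) (Lp.memLp f) k).mono_measure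
    (Measure.restrict_mono Set.Ioi_subset_Ici_self le_rfl)

/-- Reconciles `[0,∞)`, used for the measure on the rays, with `(0,∞)`, used in the Fourier
integrals; the two differ by a null set. -/
theorem coeFn_extendZero_rayComponent :
    extendZero (bundleRestrict (volume.restrict (Set.Ici 0)) f k) =ᵐ[volume]
      (Set.Ioi 0).indicator fun x : ℝ => f (onLine (zeta k) x) := by
  filter_upwards [coeFn_extendZero (bundleRestrict (volume.restrict (Set.Ici 0)) f k),
    (ae_restrict_iff' measurableSet_Ici).mp
      (coeFn_bundleRestrict (ν := volume.restrict (Set.Ici 0)) f k),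
    Measure.ae_ne volume (0 : ℝ)] with x h1 h2 h3
  rw [h1]
  by_cases hx : x ∈ Set.Ici (0 : ℝ)
  · rw [Set.indicator_of_mem hx,
      Set.indicator_of_mem (show x ∈ Set.Ioi (0 : ℝ) from lt_of_le_of_ne hx h3.symm)]
    exact h2 hx
  · have hx' : x ∉ Set.Ioi (0 : ℝ) := fun h => hx (Set.Ioi_subset_Ici_self h)
    rw [Set.indicator_of_notMem hx, Set.indicator_of_notMem hx']

theorem bundleFourier_onLine_ae_eq :
    ∀ᵐ η : ℝ, bundleFourier f (onLine (conj (zeta k)) η) =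
      angularFourier (extendZero (bundleRestrict (volume.restrict (Set.Ici 0)) f k)) η := by
  have h := coeFn_bundleRestrict (ν := volume) (bundleFourier f) (conjIndex k)
  rw [bundleRestrict_bundleFourier, conjIndex_conjIndex] at h
  rw [conj_zeta]
  exact h.symm

theorem isHardyExtension_bundleFourier :
    IsHardyExtension (conj (zeta k)) (rayFourierIntegral (zeta k) f) (bundleFourier f) :=
  isHardyExtension_rayFourierIntegral (zeta_mul_conj k) (memLp_rayComponent f k)
    (coeFn_extendZero_rayComponent f k) (bundleFourier_onLine_ae_eq f k)

theorem bundleFourier_mem_hardySum : bundleFourier f ∈ hardySum := fun k => by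
  have h := isHardyExtension_bundleFourier f (conjIndex k)
  rw [conj_zeta, conjIndex_conjIndex] at h
  exact ⟨_, h⟩

end Components

/-! ### Injectivity from Plancherel, surjectivity from Paley–Wiener -/

theorem bundleFourier_injective : Function.Injective bundleFourier := by
  rw [← LinearMap.ker_eq_bot, LinearMap.ker_eq_bot']
  intro f hf
  have h := inner_bundleFourier f f
  rw [hf, inner_zero_left] at h
  have hpi : (2 * (Real.pi : ℂ)) ≠ 0 := by exact_mod_cast Real.two_pi_pos.ne'
  exact inner_self_eq_zero.mp ((mul_eq_zero.mp h.symm).resolve_left hpi)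

/-- The rotation `z ↦ ζₖ z` maps the lower half-plane onto `ℂ₋(ζₖ)`, so Paley–Wiener applies to `z ↦
G (ζₖ z)`; the depth `a > 0` becomes the ordinate `y = -a`. -/
theorem exists_extendZero_of_memHardyMinus {g : L2Lines} {k : Fin 3}
    (hg : MemHardyMinus (zeta k) g) :
    ∃ u, angularFourier (extendZero u) = bundleRestrict volume g k := by
  obtain ⟨G, hG⟩ := hg
  obtain ⟨C, hC⟩ := hG.bounded
  have e : ∀ x y : ℝ, zeta k * ((x : ℂ) - Complex.I * ((-y : ℝ) : ℂ))
      = zeta k * (x + y * Complex.I) := fun x y => by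
    push_cast
    ring
  have hlim := hG.boundary.comp (f := fun y : ℝ => -y) (x := 𝓝[<] 0)
    (by simpa using tendsto_neg_nhdsLT (a := (0 : ℝ)))
  have h0 := angularFourier_symm_ae_eq_zero (H := fun z => G (zeta k * z)) (C := C)
    (v := bundleRestrict volume g k) ?_ ?_ ?_
  · obtain ⟨u, hu⟩ := exists_extendZero_eq h0
    exact ⟨u, by rw [hu, LinearEquiv.apply_symm_apply]⟩
  · exact hG.holomorphic.comp (by fun_prop) fun z hz => ⟨z, hz, rfl⟩
  · intro y hy
    simpa only [e] using hC (-y) (neg_pos.mpr hy)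
  · refine hlim.congr fun y => eLpNorm_congr_ae ?_
    filter_upwards [coeFn_bundleRestrict (ν := volume) g k] with x hx
    rw [e, hx]
    rfl

theorem exists_bundleFourier_eq {g : L2Lines} (hg : g ∈ hardySum) :
    ∃ f, bundleFourier f = g := by
  choose u hu using fun k => exists_extendZero_of_memHardyMinus (hg k)
  -- The preimages are indexed by lines, so they are permuted before being placed on the rays.
  obtain ⟨f, hf⟩ : ∃ f : L2Rays,
      bundleRestrict (volume.restrict (Set.Ici 0)) f = fun k => u (conjIndex k) :=
    bundleRestrict_surjective (ae_restrict_of_ae (Measure.ae_ne volume 0)) _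
  refine ⟨f, bundleRestrict_injective (ν := volume) (funext fun k => ?_)⟩
  rw [bundleRestrict_bundleFourier, hf]
  beta_reduce
  rw [conjIndex_conjIndex, hu]

end RayFourier

theorem theorem1p1 :
    ∃ F : RayFourier.L2Rays ≃ₗ[ℂ] RayFourier.hardySum,
      (∀ (f : RayFourier.L2Rays) (k : Fin 3),
        RayFourier.IsRayFourierTransform (RayFourier.zeta k) f (F f : RayFourier.L2Lines)) ∧
      (∀ f g : RayFourier.L2Rays,
        inner ℂ (F f : RayFourier.L2Lines) (F g : RayFourier.L2Lines) =
          2 * (Real.pi : ℂ) * inner ℂ f g) ∧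
      (∀ (f : RayFourier.L2Rays) (k : Fin 3),
        (∀ w ∈ RayFourier.halfPlaneMinus (conj (RayFourier.zeta k)),
          IntegrableOn (RayFourier.rayIntegrand (RayFourier.zeta k) f w) (Set.Ioi 0)) ∧
        RayFourier.IsHardyExtension (conj (RayFourier.zeta k))
          (RayFourier.rayFourierIntegral (RayFourier.zeta k) f)
          (F f : RayFourier.L2Lines)) := by
  refine ⟨LinearEquiv.ofBijective
    (RayFourier.bundleFourier.codRestrict RayFourier.hardySum RayFourier.bundleFourier_mem_hardySum)
    ⟨fun f g h => RayFourier.bundleFourier_injective (congrArg Subtype.val h), fun g => ?_⟩,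
    fun f k => ?_, RayFourier.inner_bundleFourier, fun f k => ⟨fun w hw => ?_, ?_⟩⟩
  · obtain ⟨f, hf⟩ := RayFourier.exists_bundleFourier_eq g.2
    exact ⟨f, Subtype.ext hf⟩
  · exact RayFourier.isRayFourierTransform_angularFourier (RayFourier.zeta_mul_conj k)
      (RayFourier.memLp_rayComponent f k) (RayFourier.coeFn_extendZero_rayComponent f k)
      (RayFourier.bundleFourier_onLine_ae_eq f k)
  · exact RayFourier.integrableOn_rayIntegrand (RayFourier.memLp_rayComponent f k)
      (RayFourier.mul_mem_halfPlaneMinus_conj (RayFourier.zeta_mul_conj k) hw)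
  · exact RayFourier.isHardyExtension_bundleFourier f k
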